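/- **Conventions.** A Riesz space is a real vector space with a lattice order such that $x\le y$ implies $x+z\le y+z$ and $rx\le ry$ for all real $r\ge 0$; $|a|=a\sqcup(-a)$. An element $a$ of a Riesz space $A$ is *infinitely small* if for some $b\in A$ one has $n|a|\le|b|$ for all $n\in\mathbb N$; $A$ is *Archimedean* if $0$ is its only infinitely small element. A *strong unit* is an element $u\ge 0$ such that every $a\in A$ satisfies $|a|\le nu$ for some $n\in\mathbb N$; then $(A,u)$ is called *unital*, and if $A$ is Archimedean, $\|a\|=\inf\{r\ge 0 : |a|\le ru\}$ is a norm, the *unit norm*. An *ideal* is a linear subspace $J$ such that $a\in J$ and $|b|\le|a|$ imply $b\in J$ (equivalently, the kernel of a Riesz homomorphism); a *maximal ideal* is an ideal $J\ne A$ that is contained in no other ideal different from $A$. $\mathrm{Spec}(A)$ is the set of maximal ideals with the hull–kernel topology, whose closed sets are the sets $\{J\in \mathrm{Spec}(A) : I\subseteq J\}$ with $I$ an ideal of $A$. A *formula* is a closed term built from $0$, $1$, $r\phi$ ($r\in\mathbb R$), $\phi+\psi$, $\phi\sqcup\psi$, $\phi\sqcap\psi$ and $\Diamond\phi$. Let $\mathbb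 I$ be the set of formulas modulo provable equality, in equational logic, from the axioms of modal Riesz spaces: the axioms of Riesz spaces, $0\le 1$, $\Diamond(r_1x+r_2y)=r_1\Diamond x+r_2\Diamond y$, $0\le\Diamond(x\sqcup 0)$ and $\Diamond 1\le 1$. Let $\mathbb I_a$ be the quotient of the Riesz space $\mathbb I$ by its ideal of infinitely small elements, with the class of $1$ as distinguished element. For a compact Hausdorff space $X$ let $\mathcal R^{\le 1}(X)$ be the set of Radon subprobability measures on $X$ with the weak-* topology, the coarsest for which $\mu\mapsto\int f\,d\mu$ is continuous for every $f\in C(X)$. A *Markov process* is a continuous map $\alpha:X\to\mathcal R^{\le1}(X)$ with $X$ compact Hausdorff; a *morphism* from $\alpha:X\to\mathcal R^{\le1}(X)$ to $\beta:Y\to\mathcal R^{\le1}(Y)$ is a continuous map $f:X\to Y$ such that $\int g\,d\beta(f(x))=\int g\circ f\,d\alpha(x)$ for all $x\in X$ and $g\in C(Y)$. A Markov process is *final* if every Markov process has exactly one morphism to it. **Theorem.** 1. Let $(A,u)$ be an Archimedean unital Riesz space that is separable as a metric space in its unit norm. Then $\mathrm{Spec}(A)$ is a compact Polish space. 2. $\mathbb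 I_a$ is Archimedean, the class of $1$ is a strong unit of it, and $\mathbb I_a$ is separable in its unit norm; more precisely, the classes of the formulas all of whose coefficients are rational form a countable dense subset. 3. Therefore $\mathrm{Spec}(\mathbb I_a)$ is a compact Polish space. It is the state space of the final Markov process: there is a Markov process $\mathrm{Spec}(\mathbb I_a)\to\mathcal R^{\le 1}(\mathrm{Spec}(\mathbb I_a))$ that is final. -/

import Mathlib

universe u v

namespace RieszModal

noncomputable section

/-! ### Riesz spaces

A (real) Riesz space is a type `A` with the instances
`[AddCommGroup A] [Lattice A] [IsOrderedAddMonoid A] [Module ℝ A] [PosSMulMono ℝ A]`.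
The absolute value `|a| = a ⊔ -a` is the one of Mathlib. -/

/-- The lattice given by two operations that satisfy the lattice equations; its order is
`a ≤ b ↔ a ⊓ b = a`. -/
@[reducible] def latticeOfEqs {L : Type u} (sup inf : L → L → L)
    (sup_comm : ∀ a b, sup a b = sup b a)
    (sup_assoc : ∀ a b c, sup (sup a b) c = sup a (sup b c))
    (inf_comm : ∀ a b, inf a b = inf b a)
    (inf_assoc : ∀ a b c, inf (inf a b) c = inf a (inf b c))
    (sup_inf_self : ∀ a b, sup a (inf a b) = a)
    (inf_sup_self : ∀ a b, inf a (sup a b) = a) : Lattice L where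
  sup := sup
  inf := inf
  le a b := inf a b = a
  le_refl a := by
    have h := inf_sup_self a (inf a a)
    rwa [sup_inf_self] at h
  le_trans a b c hab hbc := by
    change inf a c = a
    rw [← show inf a b = a from hab, inf_assoc, show inf b c = b from hbc]
  le_antisymm a b hab hba := by
    rw [← show inf a b = a from hab, inf_comm, show inf b a = b from hba]
  le_sup_left a b := inf_sup_self a b
  le_sup_right a b := by
    change inf b (sup a b) = b
    rw [sup_comm, inf_sup_self]
  sup_le a b c hac hbc := by
    have ha : sup a c = c := by
      rw [← show inf a c = a from hac, sup_comm, inf_comm, sup_inf_self]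
    have hb : sup b c = c := by
      rw [← show inf b c = b from hbc, sup_comm, inf_comm, sup_inf_self]
    change inf (sup a b) c = sup a b
    have h := inf_sup_self (sup a b) c
    rwa [sup_assoc, hb, ha] at h
  inf_le_left a b := by
    change inf (inf a b) a = inf a b
    have h : inf a a = a := by
      have h1 := inf_sup_self a (inf a a)
      rwa [sup_inf_self] at h1
    rw [inf_comm, ← inf_assoc, h]
  inf_le_right a b := by
    change inf (inf a b) b = inf a b
    have h : inf b b = b := by
      have h1 := inf_sup_self b (inf b b)
      rwa [sup_inf_self] at h1
    rw [inf_assoc, h]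
  le_inf a b c hab hac := by
    change inf a (inf b c) = a
    rw [← inf_assoc, show inf a b = a from hab, show inf a c = a from hac]

section Riesz

variable {A : Type u} [AddCommGroup A] [Lattice A] [Module ℝ A]

/-- An element `a` is infinitely small if there is a `b` with `n |a| ≤ |b|` for all `n`. -/
def InfinitelySmall (a : A) : Prop := ∃ b : A, ∀ n : ℕ, n • |a| ≤ |b|

variable (A) in
/-- A Riesz space is Archimedean if `0` is its only infinitely small element. -/
def IsArchimedeanRiesz : Prop := ∀ a : A, InfinitelySmall a → a = 0

/-- `e` is a strong unit: it is positive and every element is dominated by a multiple of it. -/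
def IsStrongUnit (e : A) : Prop := 0 ≤ e ∧ ∀ a : A, ∃ n : ℕ, |a| ≤ n • e

/-- The unit norm `‖a‖ = inf { r ≥ 0 | |a| ≤ r e }`. -/
def unitNorm (e a : A) : ℝ := sInf {r : ℝ | 0 ≤ r ∧ |a| ≤ r • e}

/-- `D` is dense for the metric `d(a, b) = ‖a - b‖` of the unit norm. -/
def UnitNormDense (e : A) (D : Set A) : Prop :=
  ∀ a : A, ∀ ε : ℝ, 0 < ε → ∃ d ∈ D, unitNorm e (a - d) < ε

/-- Separability for the metric of the unit norm. -/
def UnitNormSeparable (e : A) : Prop := ∃ D : Set A, D.Countable ∧ UnitNormDense e D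

/-- Riesz ideals: solid linear subspaces. By `isRieszIdeal_iff_ker` below these are exactly the
kernels of Riesz homomorphisms. -/
def IsRieszIdeal (J : Submodule ℝ A) : Prop := ∀ a ∈ J, ∀ b : A, |b| ≤ |a| → b ∈ J

/-- Maximal ideals: the ideals different from `A` that are maximal with this property. -/
def IsMaximalIdeal (J : Submodule ℝ A) : Prop :=
  IsRieszIdeal J ∧ J ≠ ⊤ ∧ ∀ K : Submodule ℝ A, IsRieszIdeal K → J ≤ K → K ≠ ⊤ → K = J

variable (A) in
/-- The spectrum: the set of all maximal ideals. -/
def Spec : Type u := {J : Submodule ℝ A // IsMaximalIdeal J}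

/-- The hull of an ideal: all maximal ideals that contain it. -/
def hull (I : Submodule ℝ A) : Set (Spec A) := {J | I ≤ J.1}

theorem mem_hull {I : Submodule ℝ A} {J : Spec A} : J ∈ hull I ↔ I ≤ J.1 := Iff.rfl

/-- A Riesz homomorphism: a linear map that preserves binary joins and meets. -/
def IsRieszHom {B : Type v} [AddCommGroup B] [Lattice B] [Module ℝ B] (f : A →ₗ[ℝ] B) : Prop :=
  (∀ a b, f (a ⊔ b) = f a ⊔ f b) ∧ ∀ a b, f (a ⊓ b) = f a ⊓ f b

theorem isRieszIdeal_inf {I K : Submodule ℝ A} (hI : IsRieszIdeal I) (hK : IsRieszIdeal K) :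
    IsRieszIdeal (I ⊓ K) := fun a ha b hb => ⟨hI a ha.1 b hb, hK a ha.2 b hb⟩

theorem isRieszIdeal_sInf {S : Set (Submodule ℝ A)} (hS : ∀ I ∈ S, IsRieszIdeal I) :
    IsRieszIdeal (sInf S) := by
  intro a ha b hb
  rw [Submodule.mem_sInf] at ha ⊢
  exact fun I hI => hS I hI a (ha I hI) b hb

theorem isRieszIdeal_top : IsRieszIdeal (⊤ : Submodule ℝ A) := fun _ _ _ _ => Submodule.mem_top

variable [IsOrderedAddMonoid A]

theorem add_inf_le {x y z : A} (hx : 0 ≤ x) (hy : 0 ≤ y) (hz : 0 ≤ z) :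
    (x + y) ⊓ z ≤ x ⊓ z + y ⊓ z := by
  rw [add_inf, inf_add, inf_add]
  refine le_inf (le_inf inf_le_left ?_) (le_inf ?_ ?_)
  · exact inf_le_right.trans (le_add_of_nonneg_right hy)
  · exact inf_le_right.trans (le_add_of_nonneg_left hx)
  · exact inf_le_right.trans (le_add_of_nonneg_left hz)

theorem abs_mem_iff {J : Submodule ℝ A} (h : IsRieszIdeal J) {a : A} : |a| ∈ J ↔ a ∈ J :=
  ⟨fun ha => h _ ha a (by rw [abs_abs]), fun ha => h _ ha _ (by rw [abs_abs])⟩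

variable [PosSMulMono ℝ A]

theorem abs_smul_le (r : ℝ) (a : A) : |r • a| ≤ |r| • |a| := by
  have key : ∀ s : ℝ, ∀ b : A, 0 ≤ s → |s • b| ≤ s • |b| := by
    intro s b hs
    refine abs_le'.2 ⟨smul_le_smul_of_nonneg_left (le_abs_self b) hs, ?_⟩
    rw [← smul_neg]
    exact smul_le_smul_of_nonneg_left (neg_le_abs b) hs
  rcases le_total 0 r with h | h
  · rw [abs_of_nonneg h]; exact key r a h
  · rw [abs_of_nonpos h, ← abs_neg (r • a), ← neg_smul]; exact key (-r) a (neg_nonneg.2 h)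

/-- Maximal ideals are prime. -/
theorem IsMaximalIdeal.prime {J : Submodule ℝ A} (hJ : IsMaximalIdeal J) {a b : A}
    (hab : |a| ⊓ |b| ∈ J) : a ∈ J ∨ b ∈ J := by
  by_contra! hcon
  have nn : ∀ c : A, 0 ≤ |c| ⊓ |b| := fun c => le_inf (abs_nonneg c) (abs_nonneg b)
  have dom : ∀ {x y : A}, 0 ≤ x → x ≤ y → y ∈ J → x ∈ J := by
    intro x y hx hxy hy
    refine hJ.1 y hy x ?_
    rwa [abs_of_nonneg hx, abs_of_nonneg (hx.trans hxy)]
  let K : Submodule ℝ A :=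
    { carrier := {c | |c| ⊓ |b| ∈ J}
      zero_mem' := by
        change |(0 : A)| ⊓ |b| ∈ J
        rw [abs_zero, inf_of_le_left (abs_nonneg b)]
        exact J.zero_mem
      add_mem' := by
        intro c d hc hd
        refine dom (nn _) ?_ (J.add_mem hc hd)
        exact (inf_le_inf_right _ (abs_add_le c d)).trans
          (add_inf_le (abs_nonneg c) (abs_nonneg d) (abs_nonneg b))
      smul_mem' := by
        intro r c hc
        have hr : (0 : ℝ) ≤ |r| + 1 := by positivity
        refine dom (nn _) ?_ (J.smul_mem (|r| + 1) hc)
        have h1 : (|r| + 1)⁻¹ • (|r • c| ⊓ |b|) ≤ |c| ⊓ |b| := by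
          have hi : (0 : ℝ) ≤ (|r| + 1)⁻¹ := by positivity
          have hle : |r| • |c| ≤ (|r| + 1) • |c| := by
            rw [add_smul, one_smul]; exact le_add_of_nonneg_right (abs_nonneg c)
          have hle' : |b| ≤ (|r| + 1) • |b| := by
            rw [add_smul, one_smul]
            refine le_add_of_nonneg_left ?_
            have := smul_le_smul_of_nonneg_left (abs_nonneg b) (abs_nonneg r)
            rwa [smul_zero] at this
          have e : ∀ x : A, (|r| + 1)⁻¹ • (|r| + 1) • x = x := fun x =>
            inv_smul_smul₀ (by positivity) x
          refine le_inf ?_ ?_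
          · rw [← e |c|]
            exact smul_le_smul_of_nonneg_left
              (inf_le_left.trans ((abs_smul_le r c).trans hle)) hi
          · rw [← e |b|]
            exact smul_le_smul_of_nonneg_left (inf_le_right.trans (by rw [e]; exact hle')) hi
        have h2 := smul_le_smul_of_nonneg_left h1 hr
        rwa [smul_inv_smul₀ (by positivity)] at h2 }
  have hK : IsRieszIdeal K := fun c hc d hd => dom (nn d) (inf_le_inf_right _ hd) hc
  have hJK : J ≤ K := fun c hc =>
    dom (nn c) inf_le_left ((abs_mem_iff hJ.1).2 hc)
  have hKtop : K ≠ ⊤ := by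
    intro h
    have hb : b ∈ K := h ▸ Submodule.mem_top
    have hb' : |b| ⊓ |b| ∈ J := hb
    rw [inf_idem] at hb'
    exact hcon.2 ((abs_mem_iff hJ.1).1 hb')
  have : K = J := hJ.2.2 K hK hJK hKtop
  exact hcon.1 (this ▸ (show a ∈ K from hab))

theorem hull_inf {I K : Submodule ℝ A} (hI : IsRieszIdeal I) (hK : IsRieszIdeal K) :
    hull I ∪ hull K = hull (I ⊓ K) := by
  ext J
  rw [Set.mem_union, mem_hull, mem_hull, mem_hull]
  constructor
  · rintro (h | h)
    · exact inf_le_left.trans h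
    · exact inf_le_right.trans h
  · intro h
    by_contra! hcon
    obtain ⟨a, haI, haJ⟩ := SetLike.not_le_iff_exists.1 hcon.1
    obtain ⟨b, hbK, hbJ⟩ := SetLike.not_le_iff_exists.1 hcon.2
    have nn : 0 ≤ |a| ⊓ |b| := le_inf (abs_nonneg a) (abs_nonneg b)
    have hmem : |a| ⊓ |b| ∈ I ⊓ K :=
      ⟨hI a haI _ (by rw [abs_of_nonneg nn]; exact inf_le_left),
        hK b hbK _ (by rw [abs_of_nonneg nn]; exact inf_le_right)⟩
    rcases J.2.prime (h hmem) with h' | h'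
    · exact haJ h'
    · exact hbJ h'

theorem exists_hull_eq_sInter {S : Set (Set (Spec A))}
    (hS : ∀ X ∈ S, ∃ I : Submodule ℝ A, IsRieszIdeal I ∧ X = hull I) :
    ∃ I : Submodule ℝ A, IsRieszIdeal I ∧ ⋂₀ S = hull I := by
  refine ⟨sInf {K : Submodule ℝ A | IsRieszIdeal K ∧ ∀ I : Submodule ℝ A, hull I ∈ S →
    IsRieszIdeal I → I ≤ K}, isRieszIdeal_sInf fun K hK => hK.1, ?_⟩
  ext J
  rw [Set.mem_sInter, mem_hull]
  constructor
  · intro h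
    exact sInf_le ⟨J.2.1, fun I hIS _ => mem_hull.1 (h _ hIS)⟩
  · intro h X hX
    obtain ⟨I, hI, rfl⟩ := hS X hX
    exact le_trans (le_sInf fun K hK => hK.2 I hX hI) h

theorem hull_top : (∅ : Set (Spec A)) = hull ⊤ := by
  ext J
  rw [mem_hull]
  exact ⟨fun h => h.elim, fun h => J.2.2.1 (top_le_iff.1 h)⟩

/-- The hull-kernel topology: the closed sets are the hulls of ideals. -/
instance hullKernelTopology : TopologicalSpace (Spec A) :=
  TopologicalSpace.ofClosed {X | ∃ I : Submodule ℝ A, IsRieszIdeal I ∧ X = hull I}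
    ⟨⊤, isRieszIdeal_top, hull_top⟩
    (fun _ hS => exists_hull_eq_sInter fun _ hX => hS hX)
    (by
      rintro X ⟨I, hI, rfl⟩ Y ⟨K, hK, rfl⟩
      exact ⟨I ⊓ K, isRieszIdeal_inf hI hK, hull_inf hI hK⟩)

theorem isClosed_iff_hull {X : Set (Spec A)} :
    IsClosed X ↔ ∃ I : Submodule ℝ A, IsRieszIdeal I ∧ X = hull I := by
  rw [← isOpen_compl_iff]
  change Xᶜᶜ ∈ {X | ∃ I : Submodule ℝ A, IsRieszIdeal I ∧ X = hull I} ↔ _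
  rw [compl_compl]
  exact Iff.rfl

/-! #### Quotients by ideals -/

theorem IsRieszIdeal.sup_sub_sup {J : Submodule ℝ A} (h : IsRieszIdeal J) {a b c d : A}
    (hab : a - b ∈ J) (hcd : c - d ∈ J) : a ⊔ c - b ⊔ d ∈ J := by
  have h1 : a ⊔ c - b ⊔ c ∈ J := h _ hab _ (abs_sup_sub_sup_le_abs a b c)
  have h2 : b ⊔ c - b ⊔ d ∈ J := by
    rw [sup_comm b c, sup_comm b d]; exact h _ hcd _ (abs_sup_sub_sup_le_abs c d b)
  simpa using J.add_mem h1 h2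

theorem IsRieszIdeal.inf_sub_inf {J : Submodule ℝ A} (h : IsRieszIdeal J) {a b c d : A}
    (hab : a - b ∈ J) (hcd : c - d ∈ J) : a ⊓ c - b ⊓ d ∈ J := by
  have h1 : a ⊓ c - b ⊓ c ∈ J := h _ hab _ (abs_inf_sub_inf_le_abs a b c)
  have h2 : b ⊓ c - b ⊓ d ∈ J := by
    rw [inf_comm b c, inf_comm b d]; exact h _ hcd _ (abs_inf_sub_inf_le_abs c d b)
  simpa using J.add_mem h1 h2

/-- The quotient lattice structure: joins and meets are computed on representatives. -/
@[reducible] def quotLattice (J : Submodule ℝ A) (h : IsRieszIdeal J) : Lattice (A ⧸ J) :=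
  latticeOfEqs
    (Quotient.map₂ (· ⊔ ·) fun _ _ hab _ _ hcd => (Submodule.quotientRel_def J).2
      (h.sup_sub_sup ((Submodule.quotientRel_def J).1 hab) ((Submodule.quotientRel_def J).1 hcd)))
    (Quotient.map₂ (· ⊓ ·) fun _ _ hab _ _ hcd => (Submodule.quotientRel_def J).2
      (h.inf_sub_inf ((Submodule.quotientRel_def J).1 hab) ((Submodule.quotientRel_def J).1 hcd)))
    (by rintro ⟨a⟩ ⟨b⟩; exact congrArg (Submodule.Quotient.mk (p := J)) (sup_comm a b))
    (by rintro ⟨a⟩ ⟨b⟩ ⟨c⟩; exact congrArg (Submodule.Quotient.mk (p := J)) (sup_assoc a b c))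
    (by rintro ⟨a⟩ ⟨b⟩; exact congrArg (Submodule.Quotient.mk (p := J)) (inf_comm a b))
    (by rintro ⟨a⟩ ⟨b⟩ ⟨c⟩; exact congrArg (Submodule.Quotient.mk (p := J)) (inf_assoc a b c))
    (by rintro ⟨a⟩ ⟨b⟩; exact congrArg (Submodule.Quotient.mk (p := J)) sup_inf_self)
    (by rintro ⟨a⟩ ⟨b⟩; exact congrArg (Submodule.Quotient.mk (p := J)) inf_sup_self)

theorem quot_isOrderedAddMonoid (J : Submodule ℝ A) (h : IsRieszIdeal J) :
    letI := quotLattice J h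
    IsOrderedAddMonoid (A ⧸ J) := by
  let _ := quotLattice J h
  refine { add_le_add_left := fun x y hxy z => ?_ }
  obtain ⟨a, rfl⟩ := Submodule.Quotient.mk_surjective J x
  obtain ⟨b, rfl⟩ := Submodule.Quotient.mk_surjective J y
  obtain ⟨c, rfl⟩ := Submodule.Quotient.mk_surjective J z
  rw [← inf_eq_left] at hxy ⊢
  refine Eq.trans ?_ (congrArg (fun x => x + Submodule.Quotient.mk (p := J) c) hxy)
  exact congrArg (Submodule.Quotient.mk (p := J)) (inf_add a b c).symm

theorem smul_inf_eq {r : ℝ} (hr : 0 ≤ r) (a b : A) : r • (a ⊓ b) = r • a ⊓ r • b := by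
  rcases hr.eq_or_lt with rfl | hpos
  · simp
  · refine le_antisymm (le_inf (smul_le_smul_of_nonneg_left inf_le_left hr)
      (smul_le_smul_of_nonneg_left inf_le_right hr)) ?_
    have hi : (0 : ℝ) ≤ r⁻¹ := by positivity
    have h1 : r⁻¹ • (r • a ⊓ r • b) ≤ a ⊓ b := by
      refine le_inf ?_ ?_
      · have h2 := smul_le_smul_of_nonneg_left (inf_le_left : r • a ⊓ r • b ≤ r • a) hi
        rwa [inv_smul_smul₀ hpos.ne'] at h2
      · have h2 := smul_le_smul_of_nonneg_left (inf_le_right : r • a ⊓ r • b ≤ r • b) hi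
        rwa [inv_smul_smul₀ hpos.ne'] at h2
    have h3 := smul_le_smul_of_nonneg_left h1 hr
    rwa [smul_inv_smul₀ hpos.ne'] at h3

theorem quot_posSMulMono (J : Submodule ℝ A) (h : IsRieszIdeal J) :
    letI := quotLattice J h
    PosSMulMono ℝ (A ⧸ J) := by
  let _ := quotLattice J h
  refine { smul_le_smul_of_nonneg_left := fun r hr x y hxy => ?_ }
  obtain ⟨a, rfl⟩ := Submodule.Quotient.mk_surjective J x
  obtain ⟨b, rfl⟩ := Submodule.Quotient.mk_surjective J y
  rw [← inf_eq_left] at hxy ⊢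
  refine Eq.trans ?_ (congrArg (fun x => r • x) hxy)
  exact congrArg (Submodule.Quotient.mk (p := J)) (smul_inf_eq hr a b).symm

/-- A linear subspace is a Riesz ideal if and only if it is the kernel of a homomorphism of Riesz
spaces. -/
theorem isRieszIdeal_iff_ker (J : Submodule ℝ A) :
    IsRieszIdeal J ↔ ∃ (B : Type u) (_ : AddCommGroup B) (_ : Lattice B)
      (_ : IsOrderedAddMonoid B) (_ : Module ℝ B) (_ : PosSMulMono ℝ B) (f : A →ₗ[ℝ] B),
      IsRieszHom f ∧ LinearMap.ker f = J := by
  constructor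
  · intro h
    exact ⟨A ⧸ J, inferInstance, quotLattice J h, quot_isOrderedAddMonoid J h, inferInstance,
      quot_posSMulMono J h, J.mkQ, ⟨fun _ _ => rfl, fun _ _ => rfl⟩, J.ker_mkQ⟩
  · rintro ⟨B, _, _, _, _, _, f, hf, rfl⟩ a ha b hb
    rw [LinearMap.mem_ker] at ha ⊢
    have habs : ∀ x, f |x| = |f x| := fun x => by
      rw [abs, abs, hf.1, map_neg]
    have h1 : |f b| ≤ |f a| := by
      rw [← habs, ← habs, ← sup_eq_right, ← hf.1, sup_eq_right.2 hb]
    rw [ha, abs_zero] at h1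
    exact le_antisymm ((le_abs_self _).trans h1) (neg_nonpos.1 ((neg_le_abs _).trans h1))

variable (A) in
/-- The ideal of infinitely small elements. -/
def infIdeal : Submodule ℝ A where
  carrier := {a | InfinitelySmall a}
  zero_mem' := ⟨0, fun n => by simp⟩
  add_mem' := by
    rintro a c ⟨b, hb⟩ ⟨d, hd⟩
    refine ⟨|b| + |d|, fun n => ?_⟩
    rw [abs_of_nonneg (add_nonneg (abs_nonneg b) (abs_nonneg d))]
    calc n • |a + c| ≤ n • (|a| + |c|) := nsmul_le_nsmul_right (abs_add_le a c) n
      _ = n • |a| + n • |c| := nsmul_add _ _ _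
      _ ≤ |b| + |d| := add_le_add (hb n) (hd n)
  smul_mem' := by
    rintro r a ⟨b, hb⟩
    refine ⟨|r| • |b|, fun n => ?_⟩
    have h1 : |r| • (n • |a|) ≤ |r| • |b| := smul_le_smul_of_nonneg_left (hb n) (abs_nonneg r)
    calc n • |r • a| ≤ n • (|r| • |a|) := nsmul_le_nsmul_right (abs_smul_le r a) n
      _ = |r| • (n • |a|) := smul_comm _ _ _
      _ ≤ |r| • |b| := h1
      _ ≤ |(|r| • |b|)| := le_abs_self _

theorem isRieszIdeal_infIdeal : IsRieszIdeal (infIdeal A) := by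
  rintro a ⟨c, hc⟩ b hb
  exact ⟨c, fun n => (nsmul_le_nsmul_right hb n).trans (hc n)⟩

end Riesz

/-! ### Riesz modal logic and its term algebra -/

/-- Formulas of Riesz modal logic: the closed terms in the signature of modal Riesz spaces. -/
inductive Form : Type
  | zero : Form
  | one : Form
  | smul : ℝ → Form → Form
  | add : Form → Form → Form
  | sup : Form → Form → Form
  | inf : Form → Form → Form
  | dia : Form → Form

/-- The formulas all of whose coefficients are rational. -/
def Form.IsRational : Form → Prop
  | .zero => True
  | .one => True
  | .smul r φ => (∃ q : ℚ, (q : ℝ) = r) ∧ φ.IsRational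
  | .add φ ψ => φ.IsRational ∧ ψ.IsRational
  | .sup φ ψ => φ.IsRational ∧ ψ.IsRational
  | .inf φ ψ => φ.IsRational ∧ ψ.IsRational
  | .dia φ => φ.IsRational

/-- `Provable φ ψ`: the equation `φ = ψ` between closed terms is derivable in equational logic from
the axioms of modal Riesz spaces. An inequality `x ≤ y` abbreviates the equation `x ⊓ y = x`, and
`-x` abbreviates `(-1) x`. -/
inductive Provable : Form → Form → Prop
  -- equational logic
  | refl (x : Form) : Provable x x
  | symm {x y : Form} : Provable x y → Provable y x
  | trans {x y z : Form} : Provable x y → Provable y z → Provable x z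
  | smul_congr (r : ℝ) {x y : Form} : Provable x y → Provable (.smul r x) (.smul r y)
  | add_congr {x x' y y' : Form} :
      Provable x x' → Provable y y' → Provable (.add x y) (.add x' y')
  | sup_congr {x x' y y' : Form} :
      Provable x x' → Provable y y' → Provable (.sup x y) (.sup x' y')
  | inf_congr {x x' y y' : Form} :
      Provable x x' → Provable y y' → Provable (.inf x y) (.inf x' y')
  | dia_congr {x y : Form} : Provable x y → Provable (.dia x) (.dia y)
  -- real vector spaces
  | add_assoc (x y z : Form) : Provable (.add x (.add y z)) (.add (.add x y) z)
  | add_comm (x y : Form) : Provable (.add x y) (.add y x)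
  | add_zero (x : Form) : Provable (.add x .zero) x
  | add_neg (x : Form) : Provable (.add x (.smul (-1) x)) .zero
  | smul_smul (r s : ℝ) (x : Form) : Provable (.smul r (.smul s x)) (.smul (r * s) x)
  | one_smul (x : Form) : Provable (.smul 1 x) x
  | smul_add (r : ℝ) (x y : Form) :
      Provable (.smul r (.add x y)) (.add (.smul r x) (.smul r y))
  | add_smul (r s : ℝ) (x : Form) :
      Provable (.smul (r + s) x) (.add (.smul r x) (.smul s x))
  -- lattices
  | sup_assoc (x y z : Form) : Provable (.sup x (.sup y z)) (.sup (.sup x y) z)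
  | inf_assoc (x y z : Form) : Provable (.inf x (.inf y z)) (.inf (.inf x y) z)
  | sup_comm (x y : Form) : Provable (.sup x y) (.sup y x)
  | inf_comm (x y : Form) : Provable (.inf x y) (.inf y x)
  | sup_absorb (x y : Form) : Provable (.sup x (.inf x y)) x
  | inf_absorb (x y : Form) : Provable (.inf x (.sup x y)) x
  | sup_idem (x : Form) : Provable (.sup x x) x
  | inf_idem (x : Form) : Provable (.inf x x) x
  -- compatibility: `(x ⊓ y) + z ≤ y + z`, and `r (x ⊓ y) ≤ r y` for `r ≥ 0`
  | add_compat (x y z : Form) :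
      Provable (.inf (.add (.inf x y) z) (.add y z)) (.add (.inf x y) z)
  | smul_compat (r : ℝ) (x y : Form) : 0 ≤ r →
      Provable (.inf (.smul r (.inf x y)) (.smul r y)) (.smul r (.inf x y))
  -- `0 ≤ 1`
  | zero_le_one : Provable (.inf .zero .one) .zero
  -- linearity of `◇`, `0 ≤ ◇ (x ⊔ 0)`, and `◇ 1 ≤ 1`
  | dia_linear (r s : ℝ) (x y : Form) :
      Provable (.dia (.add (.smul r x) (.smul s y)))
        (.add (.smul r (.dia x)) (.smul s (.dia y)))
  | dia_pos (x : Form) : Provable (.inf .zero (.dia (.sup x .zero))) .zero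
  | dia_one : Provable (.inf (.dia .one) .one) (.dia .one)

/-- Provable equality as an equivalence relation. -/
def provableSetoid : Setoid Form :=
  ⟨Provable, ⟨Provable.refl, Provable.symm, Provable.trans⟩⟩

/-- The initial modal Riesz space: formulas modulo provable equality. -/
def InitRiesz : Type := Quotient provableSetoid

namespace InitRiesz

/-- The class of a formula. -/
def mk (φ : Form) : InitRiesz := Quotient.mk provableSetoid φ

theorem mk_eq {φ ψ : Form} (h : Provable φ ψ) : mk φ = mk ψ := Quotient.sound h

instance : Zero InitRiesz := ⟨mk .zero⟩

instance : One InitRiesz := ⟨mk .one⟩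

instance : Add InitRiesz := ⟨Quotient.map₂ Form.add fun _ _ h _ _ h' => .add_congr h h'⟩

instance : SMul ℝ InitRiesz := ⟨fun r => Quotient.map (Form.smul r) fun _ _ h => .smul_congr r h⟩

instance : Neg InitRiesz := ⟨fun a => (-1 : ℝ) • a⟩

/-- The modality on the initial modal Riesz space. -/
def dia : InitRiesz → InitRiesz := Quotient.map Form.dia fun _ _ h => .dia_congr h

theorem add_comm' (a b : InitRiesz) : a + b = b + a := by
  induction a using Quotient.ind; induction b using Quotient.ind
  exact mk_eq (.add_comm _ _)

theorem add_zero' (a : InitRiesz) : a + 0 = a := by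
  induction a using Quotient.ind
  exact mk_eq (.add_zero _)

theorem add_neg' (a : InitRiesz) : a + -a = 0 := by
  induction a using Quotient.ind
  exact mk_eq (.add_neg _)

instance : AddCommGroup InitRiesz where
  add_assoc := by rintro ⟨a⟩ ⟨b⟩ ⟨c⟩; exact (mk_eq (.add_assoc a b c)).symm
  zero_add a := by rw [add_comm', add_zero']
  add_zero := add_zero'
  neg_add_cancel a := by rw [add_comm', add_neg']
  add_comm := add_comm'
  nsmul := nsmulRec
  zsmul := zsmulRec

theorem smul_add' (r : ℝ) (a b : InitRiesz) : r • (a + b) = r • a + r • b := by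
  induction a using Quotient.ind; induction b using Quotient.ind
  exact mk_eq (.smul_add _ _ _)

theorem add_smul' (r s : ℝ) (a : InitRiesz) : (r + s) • a = r • a + s • a := by
  induction a using Quotient.ind
  exact mk_eq (.add_smul _ _ _)

instance : Module ℝ InitRiesz where
  one_smul := by rintro ⟨a⟩; exact mk_eq (.one_smul a)
  mul_smul := by rintro r s ⟨a⟩; exact (mk_eq (.smul_smul r s a)).symm
  smul_zero r := by simpa using smul_add' r 0 0
  smul_add := smul_add'
  add_smul := add_smul'
  zero_smul a := by simpa using add_smul' 0 0 a

instance : Lattice InitRiesz :=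
  latticeOfEqs
    (Quotient.map₂ Form.sup fun _ _ h _ _ h' => .sup_congr h h')
    (Quotient.map₂ Form.inf fun _ _ h _ _ h' => .inf_congr h h')
    (by rintro ⟨a⟩ ⟨b⟩; exact mk_eq (.sup_comm a b))
    (by rintro ⟨a⟩ ⟨b⟩ ⟨c⟩; exact (mk_eq (.sup_assoc a b c)).symm)
    (by rintro ⟨a⟩ ⟨b⟩; exact mk_eq (.inf_comm a b))
    (by rintro ⟨a⟩ ⟨b⟩ ⟨c⟩; exact (mk_eq (.inf_assoc a b c)).symm)
    (by rintro ⟨a⟩ ⟨b⟩; exact mk_eq (.sup_absorb a b))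
    (by rintro ⟨a⟩ ⟨b⟩; exact mk_eq (.inf_absorb a b))

instance : IsOrderedAddMonoid InitRiesz where
  add_le_add_left a b hab c := by
    have h : (a ⊓ b) + c ≤ b + c := by
      rw [← inf_eq_left]
      induction a using Quotient.ind; induction b using Quotient.ind
      induction c using Quotient.ind
      exact mk_eq (.add_compat _ _ _)
    rwa [inf_eq_left.2 hab] at h

instance : PosSMulMono ℝ InitRiesz where
  smul_le_smul_of_nonneg_left r hr a b hab := by
    have h : r • (a ⊓ b) ≤ r • b := by
      rw [← inf_eq_left]
      induction a using Quotient.ind; induction b using Quotient.ind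
      exact mk_eq (.smul_compat _ _ _ hr)
    rwa [inf_eq_left.2 hab] at h

end InitRiesz

/-- The initial Archimedean modal Riesz space `𝕀ₐ`: the quotient of the initial modal Riesz space
by its ideal of infinitely small elements. -/
def ArchInit : Type := InitRiesz ⧸ infIdeal InitRiesz

namespace ArchInit

instance : AddCommGroup ArchInit :=
  inferInstanceAs (AddCommGroup (InitRiesz ⧸ infIdeal InitRiesz))

instance : Module ℝ ArchInit :=
  inferInstanceAs (Module ℝ (InitRiesz ⧸ infIdeal InitRiesz))

instance : Lattice ArchInit := quotLattice (infIdeal InitRiesz) isRieszIdeal_infIdeal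

instance : IsOrderedAddMonoid ArchInit :=
  quot_isOrderedAddMonoid (infIdeal InitRiesz) isRieszIdeal_infIdeal

instance : PosSMulMono ℝ ArchInit :=
  quot_posSMulMono (infIdeal InitRiesz) isRieszIdeal_infIdeal

/-- The class of a formula in `𝕀ₐ`. -/
def mk (φ : Form) : ArchInit :=
  Submodule.Quotient.mk (p := infIdeal InitRiesz) (InitRiesz.mk φ)

/-- The distinguished positive element of `𝕀ₐ`, the class of the formula `1`. -/
instance : One ArchInit := ⟨mk .one⟩

end ArchInit

/-! ### Markov processes -/

/-- Radon subprobability measures: Borel measures of total mass at most one such that the measure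
of each Borel set is the supremum of the measures of its compact subsets. -/
structure RadonSubprob (X : Type u) [TopologicalSpace X] where
  /-- The underlying Borel measure. -/
  measure : @MeasureTheory.Measure X (borel X)
  mass_le_one : measure Set.univ ≤ 1
  radon : ∀ S : Set X, @MeasurableSet X (borel X) S →
    measure S = ⨆ (K : Set X) (_ : K ⊆ S) (_ : IsCompact K), measure K

namespace RadonSubprob

variable {X : Type u} [TopologicalSpace X]

/-- The expectation `𝔼_μ(f) = ∫ f dμ` of a continuous function. -/
def expect (μ : RadonSubprob X) (f : C(X, ℝ)) : ℝ :=
  letI : MeasurableSpace X := borel X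
  ∫ x, f x ∂μ.measure

/-- The weak-* topology: the coarsest topology for which `μ ↦ 𝔼_μ(f)` is continuous for every
continuous `f`. -/
instance weakStarTopology : TopologicalSpace (RadonSubprob X) :=
  ⨅ f : C(X, ℝ), TopologicalSpace.induced (fun μ => μ.expect f) inferInstance

end RadonSubprob

/-- A Markov process on a (compact Hausdorff) space `X`: a continuous map from `X` to its Radon
subprobability measures. -/
abbrev MarkovProcess (X : Type u) [TopologicalSpace X] : Type u := C(X, RadonSubprob X)

/-- Coalgebra morphisms `α → β`: the image measure of `α(x)` under `f` is `β(f(x))`, expressed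
on continuous functions. -/
def IsMarkovHom {X : Type u} {Y : Type v} [TopologicalSpace X] [TopologicalSpace Y]
    (α : MarkovProcess X) (β : MarkovProcess Y) (f : C(X, Y)) : Prop :=
  ∀ (x : X) (g : C(Y, ℝ)), (β (f x)).expect g = (α x).expect (g.comp f)

/-- `α` is a final Markov process (with respect to the processes whose compact Hausdorff state
space lives in the universe `v`). -/
def IsFinalMarkov {F : Type u} [TopologicalSpace F] (α : MarkovProcess F) : Prop :=
  ∀ (X : Type v) [TopologicalSpace X] [CompactSpace X] [T2Space X] (β : MarkovProcess X),
    ∃! f : C(X, F), IsMarkovHom β α f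

end

end RieszModal

namespace RieszModal

noncomputable section

/-! ### Maximal ideals as normalized real-valued Riesz homomorphisms -/

section Yosida

variable {A : Type u} [AddCommGroup A] [Lattice A] [IsOrderedAddMonoid A] [Module ℝ A]
  [PosSMulMono ℝ A]

/-! Yosida duality carries the proof. With a strong unit `e`, each maximal ideal `J` is the kernel
of exactly one real-valued Riesz homomorphism that maps `e` to `1`. The spectrum is thus a space of
characters, and its hull-kernel topology is that of pointwise convergence. It is compact because the
characters form a closed set inside a product of intervals. Characters are 1-Lipschitz for the unit
norm, so a countable dense subset already separates points and embeds the spectrum in a countable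
power of the line.

For the term algebra, positivity of `◇` and `◇1 ≤ 1` make `◇` nonexpansive. Hence, by induction on
formulas, `1` is a strong unit and real coefficients can be approximated by rational ones. The
strong unit also makes the quotient by the infinitely small elements Archimedean.

An Archimedean unital Riesz space is a dense sublattice of the continuous functions on its spectrum.
For each `J`, the functional `a ↦ (◇a)(J)` is positive with value at most `1` at the unit, hence is
integration against a Radon subprobability measure; this is the transition law of the final process.
A state of any process is sent to its theory, the evaluation of formulas at that state. Density
makes this a morphism, and induction on formulas shows that every morphism is of this form. -/

theorem IsRieszIdeal.mem_of_nonneg_of_le {J : Submodule ℝ A} (hJ : IsRieszIdeal J) {x y : A}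
    (hx : 0 ≤ x) (hxy : x ≤ y) (hy : y ∈ J) : x ∈ J :=
  hJ y hy x (by rwa [abs_of_nonneg hx, abs_of_nonneg (hx.trans hxy)])

theorem IsStrongUnit.exists_abs_le_smul {e : A} (he : IsStrongUnit e) (a : A) :
    ∃ r : ℝ, 0 ≤ r ∧ |a| ≤ r • e := by
  obtain ⟨n, hn⟩ := he.2 a
  exact ⟨n, n.cast_nonneg, by rwa [Nat.cast_smul_eq_nsmul]⟩

theorem IsRieszIdeal.eq_top_of_unit_mem {e : A} (he : IsStrongUnit e) {J : Submodule ℝ A}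
    (hJ : IsRieszIdeal J) (h : e ∈ J) : J = ⊤ := by
  refine eq_top_iff.2 fun a _ => ?_
  obtain ⟨r, -, hr⟩ := he.exists_abs_le_smul a
  exact hJ _ (J.smul_mem r h) a (hr.trans (le_abs_self _))

theorem IsMaximalIdeal.unit_notMem {e : A} (he : IsStrongUnit e) {J : Submodule ℝ A}
    (hJ : IsMaximalIdeal J) : e ∉ J :=
  fun h => hJ.2.1 (hJ.1.eq_top_of_unit_mem he h)

/-- The elements that are dominated by an element of `J` up to arbitrarily small multiples
of `e`. -/
def approxIdeal {e : A} (he : 0 ≤ e) (J : Submodule ℝ A) : Submodule ℝ A where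
  carrier := {a | ∀ ε : ℝ, 0 < ε → ∃ j ∈ J, |a| ≤ ε • e + j}
  zero_mem' := fun ε hε => ⟨0, J.zero_mem, by simpa using smul_nonneg hε.le he⟩
  add_mem' := by
    intro a b ha hb ε hε
    obtain ⟨j, hj, haj⟩ := ha (ε / 2) (half_pos hε)
    obtain ⟨k, hk, hbk⟩ := hb (ε / 2) (half_pos hε)
    refine ⟨j + k, J.add_mem hj hk, (abs_add_le a b).trans ((add_le_add haj hbk).trans_eq ?_)⟩
    module
  smul_mem' := by
    intro t a ha ε hε
    have ht : (0 : ℝ) < |t| + 1 := by positivity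
    obtain ⟨j, hj, haj⟩ := ha (ε / (|t| + 1)) (div_pos hε ht)
    refine ⟨(|t| + 1) • j, J.smul_mem _ hj, ?_⟩
    calc |t • a| ≤ |t| • |a| := abs_smul_le t a
      _ ≤ (|t| + 1) • |a| :=
        smul_le_smul_of_nonneg_right (le_add_of_nonneg_right zero_le_one) (abs_nonneg a)
      _ ≤ (|t| + 1) • ((ε / (|t| + 1)) • e + j) := smul_le_smul_of_nonneg_left haj ht.le
      _ = ε • e + (|t| + 1) • j := by rw [smul_add, smul_smul, mul_div_cancel₀ _ ht.ne']

/-- Maximal ideals are closed under approximation up to multiples of `e`: the larger ideal is still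
proper, since `e ≤ e/2 + j` with `j ∈ J` would give `e ≤ 2j` and so `e ∈ J`. -/
theorem IsMaximalIdeal.approxIdeal_eq {e : A} (he : IsStrongUnit e) {J : Submodule ℝ A}
    (hJ : IsMaximalIdeal J) : approxIdeal he.1 J = J := by
  refine hJ.2.2 _ ?_ ?_ ?_
  · intro a ha b hb ε hε
    obtain ⟨j, hj, h⟩ := ha ε hε
    exact ⟨j, hj, hb.trans h⟩
  · intro a ha ε hε
    exact ⟨|a|, (abs_mem_iff hJ.1).2 ha,
      le_add_of_nonneg_left (smul_nonneg hε.le he.1)⟩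
  · intro h
    have hmem : e ∈ approxIdeal he.1 J := h ▸ Submodule.mem_top
    obtain ⟨j, hj, hle⟩ := hmem (1 / 2) one_half_pos
    rw [abs_of_nonneg he.1] at hle
    refine hJ.unit_notMem he (hJ.1.mem_of_nonneg_of_le he.1 ?_ (J.smul_mem (2 : ℝ) hj))
    have h2 := smul_le_smul_of_nonneg_left hle (zero_le_two (α := ℝ))
    rw [← sub_nonneg] at h2 ⊢
    refine h2.trans_eq ?_
    module

/-- A Dedekind cut: `r` is the infimum of the `s` for which `a ≤ s e` holds modulo `J`. Below the
cut the positive part is outside `J`, so primeness puts the disjoint negative part into `J`. -/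
theorem IsMaximalIdeal.exists_sub_smul_mem {e : A} (he : IsStrongUnit e) {J : Submodule ℝ A}
    (hJ : IsMaximalIdeal J) (a : A) : ∃ r : ℝ, a - r • e ∈ J := by
  set S : Set ℝ := {s | (a - s • e)⁺ ∈ J}
  obtain ⟨m, -, hm⟩ := he.exists_abs_le_smul a
  have hmS : m ∈ S := by
    change (a - m • e)⁺ ∈ J
    rw [posPart_eq_zero.2 (sub_nonpos.2 ((le_abs_self a).trans hm))]
    exact J.zero_mem
  have hbdd : ∀ s ∈ S, -m ≤ s := by
    intro s hs
    by_contra! hlt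
    refine hJ.unit_notMem he ?_
    have h1 : (-m - s) • e ≤ (a - s • e)⁺ := by
      refine le_trans ?_ (le_posPart _)
      rw [sub_smul, neg_smul]
      exact sub_le_sub_right (neg_le.1 ((neg_le_abs a).trans hm)) _
    have hpos : 0 < -m - s := sub_pos.2 hlt
    have h2 := hJ.1.mem_of_nonneg_of_le (smul_nonneg hpos.le he.1) h1 hs
    simpa [smul_smul, inv_mul_cancel₀ hpos.ne'] using J.smul_mem (-m - s)⁻¹ h2
  have hup : ∀ s, sInf S < s → (a - s • e)⁺ ∈ J := by
    intro s hs
    obtain ⟨t, ht, hts⟩ := exists_lt_of_csInf_lt ⟨m, hmS⟩ hs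
    refine hJ.1.mem_of_nonneg_of_le (posPart_nonneg _) (posPart_mono ?_) ht
    exact sub_le_sub_left (smul_le_smul_of_nonneg_right hts.le he.1) a
  have hdown : ∀ s, s < sInf S → (a - s • e)⁻ ∈ J := by
    intro s hs
    have hns : s ∉ S := fun h => (csInf_le ⟨-m, hbdd⟩ h).not_gt hs
    refine (hJ.prime (a := (a - s • e)⁺) (b := (a - s • e)⁻) ?_).resolve_left hns
    rw [abs_of_nonneg (posPart_nonneg _), abs_of_nonneg (negPart_nonneg _),
      posPart_inf_negPart_eq_zero]
    exact J.zero_mem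
  refine ⟨sInf S, ?_⟩
  -- The cut gives information only at the levels `r ± ε`; closedness of `J` under approximation
  -- lets `ε` tend to zero.
  rw [← hJ.approxIdeal_eq he]
  intro ε hε
  refine ⟨(a - (sInf S + ε) • e)⁺ + (a - (sInf S - ε) • e)⁻,
    J.add_mem (hup _ (by linarith)) (hdown _ (by linarith)), abs_le'.2 ⟨?_, ?_⟩⟩
  · calc a - sInf S • e = ε • e + (a - (sInf S + ε) • e) := by module
      _ ≤ _ := by
        gcongr
        exact (le_posPart _).trans (le_add_of_nonneg_right (negPart_nonneg _))
  · calc -(a - sInf S • e) = ε • e + -(a - (sInf S - ε) • e) := by module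
      _ ≤ _ := by
        gcongr
        exact (neg_le_negPart _).trans (le_add_of_nonneg_left (posPart_nonneg _))

theorem IsMaximalIdeal.eq_of_sub_smul_mem {e : A} (he : IsStrongUnit e) {J : Submodule ℝ A}
    (hJ : IsMaximalIdeal J) {a : A} {r s : ℝ} (hr : a - r • e ∈ J) (hs : a - s • e ∈ J) :
    r = s := by
  by_contra hne
  refine hJ.unit_notMem he ?_
  have h := J.smul_mem (s - r)⁻¹ (J.sub_mem hr hs)
  have hne' : s - r ≠ 0 := sub_ne_zero.2 (Ne.symm hne)
  rwa [show a - r • e - (a - s • e) = (s - r) • e by module, smul_smul,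
    inv_mul_cancel₀ hne', one_smul] at h

/-- The value of `a` at the maximal ideal `J`: the number `r` with `a - r e ∈ J`. -/
def value {e : A} (he : IsStrongUnit e) (J : Spec A) (a : A) : ℝ :=
  (J.2.exists_sub_smul_mem he a).choose

theorem sub_value_mem {e : A} (he : IsStrongUnit e) (J : Spec A) (a : A) :
    a - value he J a • e ∈ J.1 :=
  (J.2.exists_sub_smul_mem he a).choose_spec

theorem value_eq {e : A} (he : IsStrongUnit e) (J : Spec A) {a : A} {r : ℝ}
    (h : a - r • e ∈ J.1) : value he J a = r :=
  J.2.eq_of_sub_smul_mem he (sub_value_mem he J a) h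

/-- The Riesz homomorphism `A → ℝ` with kernel `J` that maps `e` to `1`. -/
def character {e : A} (he : IsStrongUnit e) (J : Spec A) : A →ₗ[ℝ] ℝ where
  toFun := value he J
  map_add' a b := value_eq he J (by
    have h := J.1.add_mem (sub_value_mem he J a) (sub_value_mem he J b)
    convert h using 1
    module)
  map_smul' t a := value_eq he J (by
    have h := J.1.smul_mem t (sub_value_mem he J a)
    convert h using 1
    simp only [smul_eq_mul, RingHom.id_apply]
    module)

theorem character_eq {e : A} (he : IsStrongUnit e) (J : Spec A) {a : A} {r : ℝ}
    (h : a - r • e ∈ J.1) : character he J a = r := value_eq he J h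

theorem character_unit {e : A} (he : IsStrongUnit e) (J : Spec A) : character he J e = 1 :=
  character_eq he J (by simp)

theorem character_eq_zero_iff {e : A} (he : IsStrongUnit e) (J : Spec A) {a : A} :
    character he J a = 0 ↔ a ∈ J.1 := by
  constructor
  · intro h
    have h1 : a - character he J a • e ∈ J.1 := sub_value_mem he J a
    simpa [h] using h1
  · intro h
    exact character_eq he J (by simpa using h)

theorem smul_sup_smul_of_nonneg {e : A} (he : 0 ≤ e) (r s : ℝ) :
    r • e ⊔ s • e = (r ⊔ s) • e := by
  rcases le_total r s with h | h
  · rw [sup_eq_right.2 h, sup_eq_right.2 (smul_le_smul_of_nonneg_right h he)]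
  · rw [sup_eq_left.2 h, sup_eq_left.2 (smul_le_smul_of_nonneg_right h he)]

theorem smul_inf_smul_of_nonneg {e : A} (he : 0 ≤ e) (r s : ℝ) :
    r • e ⊓ s • e = (r ⊓ s) • e := by
  rcases le_total r s with h | h
  · rw [inf_eq_left.2 h, inf_eq_left.2 (smul_le_smul_of_nonneg_right h he)]
  · rw [inf_eq_right.2 h, inf_eq_right.2 (smul_le_smul_of_nonneg_right h he)]

theorem isRieszHom_character {e : A} (he : IsStrongUnit e) (J : Spec A) :
    IsRieszHom (character he J) := by
  refine ⟨fun a b => character_eq he J ?_, fun a b => character_eq he J ?_⟩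
  · rw [← smul_sup_smul_of_nonneg he.1]
    exact J.2.1.sup_sub_sup (sub_value_mem he J a) (sub_value_mem he J b)
  · rw [← smul_inf_smul_of_nonneg he.1]
    exact J.2.1.inf_sub_inf (sub_value_mem he J a) (sub_value_mem he J b)

theorem IsRieszHom.monotone {B : Type v} [AddCommGroup B] [Lattice B] [Module ℝ B]
    {f : A →ₗ[ℝ] B} (hf : IsRieszHom f) : Monotone f := fun a b hab => by
  rw [← sup_eq_right, ← hf.1, sup_eq_right.2 hab]

theorem IsRieszHom.map_abs {B : Type v} [AddCommGroup B] [Lattice B] [Module ℝ B]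
    {f : A →ₗ[ℝ] B} (hf : IsRieszHom f) (a : A) : f |a| = |f a| := by
  rw [abs, hf.1, map_neg, abs]

theorem IsRieszHom.map_posPart {B : Type v} [AddCommGroup B] [Lattice B] [Module ℝ B]
    {f : A →ₗ[ℝ] B} (hf : IsRieszHom f) (a : A) : f a⁺ = (f a)⁺ := by
  rw [posPart_def, hf.1, map_zero, posPart_def]

/-- Kernels of normalized real-valued Riesz homomorphisms are maximal. -/
theorem isMaximalIdeal_ker {e : A} (he : IsStrongUnit e) {h : A →ₗ[ℝ] ℝ} (hh : IsRieszHom h)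
    (h1 : h e = 1) : IsMaximalIdeal (LinearMap.ker h) := by
  refine ⟨?_, ?_, ?_⟩
  · intro a ha b hab
    rw [LinearMap.mem_ker] at ha ⊢
    have := hh.monotone hab
    rw [hh.map_abs, hh.map_abs, ha, abs_zero] at this
    exact abs_nonpos_iff.1 this
  · intro htop
    have : e ∈ LinearMap.ker h := htop ▸ Submodule.mem_top
    rw [LinearMap.mem_ker, h1] at this
    exact one_ne_zero this
  · intro K hK hle hne
    refine le_antisymm (fun a ha => ?_) hle
    by_contra hna
    have hna' : h a ≠ 0 := hna
    refine hne (hK.eq_top_of_unit_mem he ?_)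
    -- The kernel has codimension one: `e` is a multiple of `a` modulo the kernel, so an ideal that
    -- contains both the kernel and `a` contains `e`.
    have h2 : e - (h a)⁻¹ • a ∈ K := hle (by
      rw [LinearMap.mem_ker, map_sub, map_smul, h1, smul_eq_mul, inv_mul_cancel₀ hna', sub_self])
    simpa using K.add_mem h2 (K.smul_mem (h a)⁻¹ ha)

/-- The point of the spectrum given by a normalized real-valued Riesz homomorphism. -/
def pointOfHom {e : A} (he : IsStrongUnit e) {h : A →ₗ[ℝ] ℝ} (hh : IsRieszHom h)
    (h1 : h e = 1) : Spec A := ⟨LinearMap.ker h, isMaximalIdeal_ker he hh h1⟩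

theorem character_pointOfHom {e : A} (he : IsStrongUnit e) {h : A →ₗ[ℝ] ℝ} (hh : IsRieszHom h)
    (h1 : h e = 1) (a : A) : character he (pointOfHom he hh h1) a = h a :=
  character_eq he _ (by
    change a - h a • e ∈ LinearMap.ker h
    rw [LinearMap.mem_ker, map_sub, map_smul, h1, smul_eq_mul, mul_one, sub_self])

theorem spec_ext {e : A} (he : IsStrongUnit e) {J K : Spec A}
    (h : ∀ a, character he J a = character he K a) : J = K :=
  Subtype.ext (Submodule.ext fun a => by
    rw [← character_eq_zero_iff he J, ← character_eq_zero_iff he K, h])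

/-! ### The topology of the spectrum -/

theorem isClosed_setOf_mem (a : A) : IsClosed {J : Spec A | a ∈ J.1} := by
  rw [isClosed_iff_hull]
  refine ⟨sInf {K : Submodule ℝ A | IsRieszIdeal K ∧ a ∈ K},
    isRieszIdeal_sInf fun K hK => hK.1, ?_⟩
  ext J
  rw [mem_hull]
  exact ⟨fun h => sInf_le ⟨J.2.1, h⟩,
    fun h => h ((Submodule.mem_sInf).2 fun K hK => hK.2)⟩

/-- The set where `b ≤ r` is the set of `J` containing `(b - r e)⁺`, hence closed. Applied to `a`
and `-a`, this gives both semicontinuities. -/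
theorem continuous_character {e : A} (he : IsStrongUnit e) (a : A) :
    Continuous fun J : Spec A => character he J a := by
  have key : ∀ (b : A) (r : ℝ), IsClosed {J : Spec A | character he J b ≤ r} := by
    intro b r
    convert isClosed_setOf_mem (b - r • e)⁺ using 1
    ext J
    rw [Set.mem_ofPred_eq, Set.mem_ofPred_eq, ← character_eq_zero_iff he,
      (isRieszHom_character he J).map_posPart, posPart_eq_zero, map_sub, map_smul,
      character_unit he, smul_eq_mul, mul_one, sub_nonpos]
  rw [continuous_iff_lower_upperSemicontinuous]
  refine ⟨lowerSemicontinuous_iff_isClosed_preimage.2 (key a),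
    upperSemicontinuous_iff_isClosed_preimage.2 fun r => ?_⟩
  convert key (-a) (-r) using 1
  ext J
  simp

/-- The embedding of the spectrum into the product of copies of the real line. -/
theorem isClosedEmbedding_character {e : A} (he : IsStrongUnit e) :
    Topology.IsClosedEmbedding fun (J : Spec A) (a : A) => character he J a := by
  have hinj : Function.Injective fun (J : Spec A) (a : A) => character he J a :=
    fun J K h => spec_ext he (congrFun h)
  have hcont : Continuous fun (J : Spec A) (a : A) => character he J a :=
    continuous_pi (continuous_character he)
  refine ⟨⟨⟨le_antisymm hcont.le_induced ?_⟩, hinj⟩, ?_⟩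
  · intro U hU
    -- The hull of `I` is the preimage of the functions that vanish on `I`, a closed subset of the
    -- product.
    obtain ⟨I, -, hI⟩ := isClosed_iff_hull.1 hU.isClosed_compl
    refine isOpen_induced_iff.2 ⟨(⋂ a ∈ I, {f : A → ℝ | f a = 0})ᶜ, ?_, ?_⟩
    · exact (isClosed_biInter fun a _ =>
        isClosed_eq (continuous_apply a) continuous_const).isOpen_compl
    · rw [← compl_compl U, hI, Set.preimage_compl]
      congr 1
      ext J
      simp [mem_hull, character_eq_zero_iff, SetLike.le_def]
  -- The image is cut out by the equations of a normalized Riesz homomorphism, each of which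
  -- involves finitely many coordinates and is a closed condition.
  · have : Set.range (fun (J : Spec A) (a : A) => character he J a) =
      {h : A → ℝ | (∀ a b, h (a + b) = h a + h b) ∧ (∀ (t : ℝ) (a), h (t • a) = t * h a) ∧
        (∀ a b, h (a ⊔ b) = h a ⊔ h b) ∧ (∀ a b, h (a ⊓ b) = h a ⊓ h b) ∧ h e = 1} := by
      ext h
      constructor
      · rintro ⟨J, rfl⟩
        exact ⟨map_add _, map_smul _, (isRieszHom_character he J).1,
          (isRieszHom_character he J).2, character_unit he J⟩
      · rintro ⟨hadd, hsmul, hsup, hinf, h1⟩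
        let g : A →ₗ[ℝ] ℝ := { toFun := h, map_add' := hadd, map_smul' := hsmul }
        exact ⟨pointOfHom he (h := g) ⟨hsup, hinf⟩ h1,
          funext (character_pointOfHom he (h := g) ⟨hsup, hinf⟩ h1)⟩
    rw [this]
    simp only [Set.ofPred_and, Set.ofPred_forall]
    refine IsClosed.inter ?_ (IsClosed.inter ?_ (IsClosed.inter ?_ (IsClosed.inter ?_ ?_)))
    · exact isClosed_iInter fun a => isClosed_iInter fun b =>
        isClosed_eq (by fun_prop) (by fun_prop)
    · exact isClosed_iInter fun a => isClosed_iInter fun b =>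
        isClosed_eq (by fun_prop) (by fun_prop)
    · exact isClosed_iInter fun a => isClosed_iInter fun b =>
        isClosed_eq (by fun_prop) (by fun_prop)
    · exact isClosed_iInter fun a => isClosed_iInter fun b =>
        isClosed_eq (by fun_prop) (by fun_prop)
    · exact isClosed_eq (by fun_prop) (by fun_prop)

theorem abs_character_le {e : A} (he : IsStrongUnit e) (J : Spec A) {a : A} {r : ℝ}
    (h : |a| ≤ r • e) : |character he J a| ≤ r := by
  have h1 := (isRieszHom_character he J).monotone h
  rwa [(isRieszHom_character he J).map_abs, map_smul, character_unit, smul_eq_mul, mul_one] at h1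

theorem compactSpace_spec {e : A} (he : IsStrongUnit e) : CompactSpace (Spec A) := by
  choose r hr0 hr using he.exists_abs_le_smul
  have hK : IsCompact (Set.univ.pi fun a : A => Set.Icc (-(r a)) (r a)) :=
    isCompact_univ_pi fun a => isCompact_Icc
  have := (isClosedEmbedding_character he).isCompact_preimage hK
  rw [← isCompact_univ_iff]
  convert this using 1
  symm
  rw [Set.eq_univ_iff_forall]
  exact fun J a _ => abs_le.1 (abs_character_le he J (hr a))

theorem t2Space_spec {e : A} (he : IsStrongUnit e) : T2Space (Spec A) :=
  (isClosedEmbedding_character he).isEmbedding.t2Space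

theorem abs_le_smul_of_unitNorm_lt {e : A} (he : IsStrongUnit e) {a : A} {ε : ℝ}
    (h : unitNorm e a < ε) : |a| ≤ ε • e := by
  obtain ⟨r, ⟨-, hr⟩, hlt⟩ := exists_lt_of_csInf_lt
    (s := {r : ℝ | 0 ≤ r ∧ |a| ≤ r • e}) (he.exists_abs_le_smul a) h
  exact hr.trans (smul_le_smul_of_nonneg_right hlt.le he.1)

theorem unitNorm_le {e a : A} {r : ℝ} (hr : 0 ≤ r) (h : |a| ≤ r • e) : unitNorm e a ≤ r :=
  csInf_le ⟨0, fun _ hs => hs.1⟩ ⟨hr, h⟩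

/-- Two characters that agree on a dense set agree everywhere, being 1-Lipschitz. Evaluation on a
countable dense set is therefore a continuous injection of a compact space into a second countable
Hausdorff one, hence an embedding. -/
theorem polishSpace_spec {e : A} (he : IsStrongUnit e) (hsep : UnitNormSeparable e) :
    PolishSpace (Spec A) := by
  have := compactSpace_spec he
  have := t2Space_spec he
  obtain ⟨D, hD, hdense⟩ := hsep
  have := hD.to_subtype
  have hcont : Continuous fun (J : Spec A) (d : D) => character he J d :=
    continuous_pi fun d => continuous_character he d
  have hinj : Function.Injective fun (J : Spec A) (d : D) => character he J d := by
    intro J K h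
    refine spec_ext he fun a => ?_
    refine eq_of_forall_dist_le fun ε hε => ?_
    obtain ⟨d, hd, hlt⟩ := hdense a (ε / 2) (half_pos hε)
    have hle := abs_le_smul_of_unitNorm_lt he hlt
    have h1 := abs_character_le he J hle
    have h2 := abs_character_le he K hle
    have h3 : character he J d = character he K d := congrFun h ⟨d, hd⟩
    rw [map_sub, abs_le] at h1 h2
    rw [Real.dist_eq, abs_le]
    constructor <;> linarith [h1.1, h1.2, h2.1, h2.2]
  have hemb := (hcont.isClosedEmbedding hinj).isEmbedding
  have := hemb.secondCountableTopology
  have := TopologicalSpace.metrizableSpace_of_t3_secondCountable (Spec A)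
  let _ := TopologicalSpace.metrizableSpaceMetric (Spec A)
  infer_instance

end Yosida

/-! ### Representation by continuous functions on the spectrum -/

section Representation

variable {A : Type u} [AddCommGroup A] [Lattice A] [IsOrderedAddMonoid A] [Module ℝ A]
  [PosSMulMono ℝ A]

/-- Zorn's lemma for the ideals that miss `e`. For a strong unit, missing `e` is the same as being
proper, and it survives unions of chains. -/
theorem exists_le_maximal {e : A} (he : IsStrongUnit e) {I : Submodule ℝ A}
    (hI : IsRieszIdeal I) (heI : e ∉ I) : ∃ J : Spec A, I ≤ J.1 := by
  obtain ⟨M, hIM, hM⟩ := zorn_le_nonempty₀ {K : Submodule ℝ A | IsRieszIdeal K ∧ e ∉ K} (by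
    intro c hc hchain K hK
    have hmem := fun x => Submodule.mem_sSup_of_directed (z := x) ⟨K, hK⟩ hchain.directedOn
    refine ⟨sSup c, ⟨?_, ?_⟩, fun L hL => le_sSup hL⟩
    · intro a ha b hb
      obtain ⟨L, hL, haL⟩ := (hmem a).1 ha
      exact (hmem b).2 ⟨L, hL, (hc hL).1 a haL b hb⟩
    · intro h
      obtain ⟨L, hL, heL⟩ := (hmem e).1 h
      exact (hc hL).2 heL) I ⟨hI, heI⟩
  refine ⟨⟨M, hM.prop.1, ?_, ?_⟩, hIM⟩
  · intro h
    exact hM.prop.2 (h ▸ Submodule.mem_top)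
  · intro K hK hMK hne
    exact le_antisymm (hM.le_of_ge ⟨hK, fun h => hne (hK.eq_top_of_unit_mem he h)⟩ hMK) hMK

/-- The ideal generated by `c`. -/
def principalIdeal (c : A) : Submodule ℝ A where
  carrier := {a | ∃ r : ℝ, 0 ≤ r ∧ |a| ≤ r • c}
  zero_mem' := ⟨0, le_rfl, by simp⟩
  add_mem' := by
    rintro a b ⟨r, hr, ha⟩ ⟨s, hs, hb⟩
    exact ⟨r + s, add_nonneg hr hs,
      (abs_add_le a b).trans ((add_le_add ha hb).trans_eq (add_smul r s c).symm)⟩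
  smul_mem' := by
    rintro t a ⟨r, hr, ha⟩
    refine ⟨|t| * r, mul_nonneg (abs_nonneg t) hr, (abs_smul_le t a).trans ?_⟩
    rw [mul_smul]
    exact smul_le_smul_of_nonneg_left ha (abs_nonneg t)

theorem isRieszIdeal_principalIdeal (c : A) : IsRieszIdeal (principalIdeal c) := by
  rintro a ⟨r, hr, ha⟩ b hb
  exact ⟨r, hr, hb.trans ha⟩

theorem nsmul_inf_eq_zero {x y : A} (hx : 0 ≤ x) (hy : 0 ≤ y) (h : x ⊓ y = 0) (n : ℕ) :
    (n • x) ⊓ y = 0 := by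
  induction n with
  | zero => simpa using hy
  | succ n ih =>
    refine le_antisymm ?_ (le_inf (nsmul_nonneg hx _) hy)
    rw [succ_nsmul]
    exact (add_inf_le (nsmul_nonneg hx n) hx hy).trans (by rw [ih, h, add_zero])

/-- An element that is not negative is positive at some point of the spectrum. -/
theorem exists_character_nonneg_of_not_nonpos {e : A} (he : IsStrongUnit e) {c : A}
    (hc : ¬c ≤ 0) : ∃ J : Spec A, 0 ≤ character he J c := by
  -- If `e` were dominated by a multiple of `c⁻`, it would be disjoint from `c⁺`. Then so would `n e
  -- ≥ c⁺`, which forces `c⁺ = 0`.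
  have hnot : e ∉ principalIdeal c⁻ := by
    rintro ⟨r, -, hr⟩
    rw [abs_of_nonneg he.1] at hr
    obtain ⟨m, hm⟩ := exists_nat_ge r
    have h1 : e ≤ m • c⁻ := by
      rw [← Nat.cast_smul_eq_nsmul ℝ]
      exact hr.trans (smul_le_smul_of_nonneg_right hm (negPart_nonneg c))
    have h2 : e ⊓ c⁺ = 0 := by
      refine le_antisymm ?_ (le_inf he.1 (posPart_nonneg c))
      refine (inf_le_inf_right _ h1).trans_eq ?_
      refine nsmul_inf_eq_zero (negPart_nonneg c) (posPart_nonneg c) ?_ m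
      rw [inf_comm, posPart_inf_negPart_eq_zero]
    obtain ⟨n, hn⟩ := he.2 c⁺
    rw [abs_of_nonneg (posPart_nonneg c)] at hn
    have h3 := nsmul_inf_eq_zero he.1 (posPart_nonneg c) h2 n
    rw [inf_eq_right.2 hn] at h3
    exact hc (posPart_eq_zero.1 h3)
  obtain ⟨J, hJ⟩ := exists_le_maximal he (isRieszIdeal_principalIdeal c⁻) hnot
  refine ⟨J, ?_⟩
  have h1 : character he J c⁻ = 0 := (character_eq_zero_iff he J).2
    (hJ ⟨1, zero_le_one, by rw [abs_of_nonneg (negPart_nonneg c), one_smul]⟩)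
  have h2 := (isRieszHom_character he J).monotone (posPart_nonneg c)
  rw [← posPart_sub_negPart c, map_sub, h1, sub_zero]
  simpa using h2

/-- The negative part `a⁻` vanishes at every character, so `n a⁻ - e` has value `-1` everywhere and
must be `≤ 0`. Thus `a⁻` is infinitely small. -/
theorem nonneg_of_character_nonneg (hA : IsArchimedeanRiesz A) {e : A} (he : IsStrongUnit e)
    {a : A} (h : ∀ J : Spec A, 0 ≤ character he J a) : 0 ≤ a := by
  rw [← negPart_eq_zero]
  refine hA _ ⟨e, fun n => ?_⟩
  rw [abs_of_nonneg (negPart_nonneg a), abs_of_nonneg he.1, ← sub_nonpos]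
  by_contra hcon
  obtain ⟨J, hJ⟩ := exists_character_nonneg_of_not_nonpos he hcon
  have h1 : character he J a⁻ = 0 := by
    rw [negPart_def, (isRieszHom_character he J).1, map_neg, map_zero]
    simpa using h J
  rw [map_sub, map_nsmul, h1, character_unit] at hJ
  norm_num at hJ

/-- The elements of `A` as continuous functions on the spectrum. -/
def toContinuous {e : A} (he : IsStrongUnit e) : A →ₗ[ℝ] C(Spec A, ℝ) where
  toFun a := ⟨fun J => character he J a, continuous_character he a⟩
  map_add' a b := by ext J; exact map_add (character he J) a b
  map_smul' t a := by ext J; exact map_smul (character he J) t a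

theorem toContinuous_apply {e : A} (he : IsStrongUnit e) (a : A) (J : Spec A) :
    toContinuous he a J = character he J a := rfl

theorem toContinuous_unit {e : A} (he : IsStrongUnit e) : toContinuous he e = 1 := by
  ext J
  exact character_unit he J

theorem toContinuous_injective (hA : IsArchimedeanRiesz A) {e : A} (he : IsStrongUnit e) :
    Function.Injective (toContinuous he) := by
  rw [injective_iff_map_eq_zero]
  intro a ha
  have h : ∀ J, character he J a = 0 := fun J => DFunLike.congr_fun ha J
  refine le_antisymm ?_ (nonneg_of_character_nonneg hA he fun J => (h J).ge)
  rw [← neg_nonneg]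
  exact nonneg_of_character_nonneg hA he fun J => by rw [map_neg, h J, neg_zero]

/-- The lattice form of the Stone–Weierstrass theorem: the image is a sublattice that interpolates
arbitrary values at any two points. -/
theorem denseRange_toContinuous {e : A} (he : IsStrongUnit e) :
    DenseRange (toContinuous he) := by
  have := compactSpace_spec he
  refine dense_iff_closure_eq.2
    (ContinuousMap.sublattice_closure_eq_top _ ⟨_, 0, rfl⟩ ?_ ?_ ?_)
  · rintro _ ⟨a, rfl⟩ _ ⟨b, rfl⟩
    exact ⟨a ⊓ b, by ext J; exact (isRieszHom_character he J).2 a b⟩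
  · rintro _ ⟨a, rfl⟩ _ ⟨b, rfl⟩
    exact ⟨a ⊔ b, by ext J; exact (isRieszHom_character he J).1 a b⟩
  · intro v J K
    by_cases hJK : J = K
    · subst hJK
      refine ⟨_, ⟨v J • e, rfl⟩, ?_⟩
      simp [toContinuous_apply, character_unit]
    · obtain ⟨a, ha⟩ := not_forall.1 (mt (spec_ext he) hJK)
      have hne : character he J a - character he K a ≠ 0 := sub_ne_zero.2 ha
      -- Affine interpolation: `a` separates the two points and `e` supplies the constants.
      refine ⟨_, ⟨((v J - v K) / (character he J a - character he K a)) •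
        (a - character he K a • e) + v K • e, rfl⟩, ?_⟩
      constructor <;> rw [toContinuous_apply] <;>
        simp only [map_add, map_smul, map_sub, character_unit, smul_eq_mul, mul_one]
      · rw [div_mul_cancel₀ _ hne, sub_add_cancel]
      · simp

theorem exists_norm_sub_toContinuous_lt {e : A} (he : IsStrongUnit e) [CompactSpace (Spec A)]
    (f : C(Spec A, ℝ)) {ε : ℝ} (hε : 0 < ε) : ∃ a, ‖f - toContinuous he a‖ < ε := by
  obtain ⟨a, ha⟩ := (denseRange_toContinuous he).exists_dist_lt f hε
  exact ⟨a, by rwa [← dist_eq_norm]⟩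

end Representation

/-! ### Expectations -/

namespace RadonSubprob

variable {X : Type u} [TopologicalSpace X]

theorem isFiniteMeasure (μ : RadonSubprob X) :
    letI : MeasurableSpace X := borel X
    MeasureTheory.IsFiniteMeasure μ.measure :=
  letI : MeasurableSpace X := borel X
  ⟨μ.mass_le_one.trans_lt ENNReal.one_lt_top⟩

variable [CompactSpace X]

theorem integrable (μ : RadonSubprob X) (f : C(X, ℝ)) :
    letI : MeasurableSpace X := borel X
    MeasureTheory.Integrable (fun x => f x) μ.measure := by
  let _ : MeasurableSpace X := borel X
  have : BorelSpace X := ⟨rfl⟩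
  have := μ.isFiniteMeasure
  exact (BoundedContinuousFunction.mkOfCompact f).integrable μ.measure

/-- The expectation as a linear functional. -/
def expectLinear (μ : RadonSubprob X) : C(X, ℝ) →ₗ[ℝ] ℝ where
  toFun := μ.expect
  map_add' f g := MeasureTheory.integral_add (μ.integrable f) (μ.integrable g)
  map_smul' r _ := MeasureTheory.integral_const_mul r _

theorem expect_add (μ : RadonSubprob X) (f g : C(X, ℝ)) :
    μ.expect (f + g) = μ.expect f + μ.expect g := μ.expectLinear.map_add f g

theorem expect_sub (μ : RadonSubprob X) (f g : C(X, ℝ)) :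
    μ.expect (f - g) = μ.expect f - μ.expect g := μ.expectLinear.map_sub f g

theorem expect_smul (μ : RadonSubprob X) (r : ℝ) (f : C(X, ℝ)) :
    μ.expect (r • f) = r * μ.expect f := μ.expectLinear.map_smul r f

theorem expect_nonneg (μ : RadonSubprob X) {f : C(X, ℝ)} (hf : 0 ≤ f) : 0 ≤ μ.expect f :=
  MeasureTheory.integral_nonneg hf

theorem expect_one_le (μ : RadonSubprob X) : μ.expect 1 ≤ 1 := by
  let _ : MeasurableSpace X := borel X
  have h : μ.expect 1 = μ.measure.real Set.univ := by simp [expect]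
  rw [h, MeasureTheory.measureReal_def]
  exact ENNReal.toReal_le_of_le_ofReal zero_le_one (by simpa using μ.mass_le_one)

theorem abs_expect_le (μ : RadonSubprob X) (f : C(X, ℝ)) : |μ.expect f| ≤ ‖f‖ := by
  have key : ∀ g : C(X, ℝ), (∀ x, g x ≤ ‖f‖) → μ.expect g ≤ ‖f‖ := by
    intro g hg
    have h := μ.expect_nonneg (f := ‖f‖ • 1 - g) (fun x => by simpa using hg x)
    rw [expect_sub, expect_smul] at h
    -- The product needed is `‖f‖ (1 - μ(1)) ≥ 0`.
    nlinarith [μ.expect_one_le, norm_nonneg f]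
  refine abs_le'.2 ⟨key f fun x => (le_abs_self _).trans (f.norm_coe_le_norm x), ?_⟩
  have h := key (-f) fun x => (neg_le_abs _).trans (f.norm_coe_le_norm x)
  rwa [show μ.expect (-f) = -μ.expect f from μ.expectLinear.map_neg f] at h

theorem continuous_expect (f : C(X, ℝ)) : Continuous fun μ : RadonSubprob X => μ.expect f :=
  continuous_iff_le_induced.2 (iInf_le _ f)

theorem continuous_of_continuous_expect {Y : Type v} [TopologicalSpace Y] {α : Y → RadonSubprob X}
    (h : ∀ f : C(X, ℝ), Continuous fun y => (α y).expect f) : Continuous α :=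
  continuous_iInf_rng.2 fun f => continuous_induced_rng.2 (h f)

/-- The Riesz–Markov–Kakutani theorem for functionals of norm at most one. -/
theorem exists_expect_eq [T2Space X] (Λ : C(X, ℝ) →ₗ[ℝ] ℝ) (hΛ : ∀ f, 0 ≤ f → 0 ≤ Λ f)
    (h1 : Λ 1 ≤ 1) : ∃ μ : RadonSubprob X, ∀ f, μ.expect f = Λ f := by
  let _ : MeasurableSpace X := borel X
  have : BorelSpace X := ⟨rfl⟩
  -- On a compact space every continuous function has compact support.
  let Λ' : CompactlySupportedContinuousMap X ℝ →ₚ[ℝ] ℝ := PositiveLinearMap.mk₀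
    { toFun := fun f => Λ f.toContinuousMap
      map_add' := fun f g => Λ.map_add f.toContinuousMap g.toContinuousMap
      map_smul' := fun r f => Λ.map_smul r f.toContinuousMap } fun f hf => hΛ _ hf
  have hint : ∀ f : C(X, ℝ), ∫ x, f x ∂(RealRMK.rieszMeasure Λ') = Λ f := fun f =>
    RealRMK.integral_rieszMeasure Λ' (CompactlySupportedContinuousMap.continuousMapEquiv f)
  refine ⟨⟨RealRMK.rieszMeasure Λ', ?_, fun S hS =>
    hS.measure_eq_iSup_isCompact_of_ne_top (MeasureTheory.measure_ne_top _ S)⟩, hint⟩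
  have h := hint 1
  simp only [ContinuousMap.one_apply, MeasureTheory.integral_const, smul_eq_mul, mul_one] at h
  rw [← h, MeasureTheory.measureReal_def] at h1
  rw [← ENNReal.ofReal_toReal (MeasureTheory.measure_ne_top (RealRMK.rieszMeasure Λ') Set.univ)]
  exact ENNReal.ofReal_le_one.2 h1

end RadonSubprob

/-! ### Positive functionals as measures on the spectrum -/

section Representation

variable {A : Type u} [AddCommGroup A] [Lattice A] [IsOrderedAddMonoid A] [Module ℝ A]
  [PosSMulMono ℝ A]

/-- Positive functionals of norm at most one on an Archimedean unital Riesz space are given by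
Radon measures on the spectrum. -/
theorem exists_expect_toContinuous_eq (hA : IsArchimedeanRiesz A) {e : A} (he : IsStrongUnit e)
    (φ : A →ₗ[ℝ] ℝ) (hφ : ∀ a, 0 ≤ a → 0 ≤ φ a) (h1 : φ e ≤ 1) :
    ∃ μ : RadonSubprob (Spec A), ∀ a, μ.expect (toContinuous he a) = φ a := by
  have := compactSpace_spec he
  have := t2Space_spec he
  let E := LinearEquiv.ofInjective (toContinuous he) (toContinuous_injective hA he)
  have hE : ∀ a, φ (E.symm (E a)) = φ a := fun a => by rw [E.symm_apply_apply]
  -- M. Riesz extension from the image of `A` to all continuous functions. Positivity on the image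
  -- holds because pointwise positivity implies positivity in `A`; the constant `‖f‖` lies in the
  -- image and makes `f` nonnegative when added.
  obtain ⟨g, hg, hpos⟩ := riesz_extension (PointedCone.positive ℝ C(Spec A, ℝ))
    ⟨LinearMap.range (toContinuous he), φ ∘ₗ E.symm.toLinearMap⟩ (by
      intro x hx
      obtain ⟨a, rfl⟩ := E.surjective x
      refine (hφ a (nonneg_of_character_nonneg hA he fun J => ?_)).trans_eq (hE a).symm
      exact hx J) (by
      intro f
      refine ⟨⟨toContinuous he (‖f‖ • e), LinearMap.mem_range_self _ _⟩, fun J => ?_⟩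
      have h := (neg_le_abs _).trans (f.norm_coe_le_norm J)
      simp only [map_smul, toContinuous_unit]
      simpa using by linarith)
  have hgφ : ∀ a, g (toContinuous he a) = φ a := fun a => (hg (E a)).trans (hE a)
  obtain ⟨μ, hμ⟩ := RadonSubprob.exists_expect_eq g hpos (by
    rw [← toContinuous_unit he, hgφ]; exact h1)
  exact ⟨μ, fun a => (hμ _).trans (hgφ a)⟩

end Representation

/-! ### The initial modal Riesz space -/

namespace InitRiesz

theorem zero_le_one' : (0 : InitRiesz) ≤ 1 := inf_eq_left.1 (mk_eq .zero_le_one)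

theorem dia_linear (r s : ℝ) (a b : InitRiesz) :
    dia (r • a + s • b) = r • dia a + s • dia b := by
  induction a using Quotient.ind; induction b using Quotient.ind
  exact mk_eq (.dia_linear _ _ _ _)

/-- The modality as a linear map. -/
def diaLinear : InitRiesz →ₗ[ℝ] InitRiesz where
  toFun := dia
  map_add' a b := by simpa using dia_linear 1 1 a b
  map_smul' r a := by simpa using dia_linear r 0 a 0

theorem dia_nonneg {a : InitRiesz} (ha : 0 ≤ a) : 0 ≤ diaLinear a := by
  have h : 0 ≤ dia (a ⊔ 0) := by
    rw [← inf_eq_left]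
    induction a using Quotient.ind
    exact mk_eq (.dia_pos _)
  rwa [sup_eq_left.2 ha] at h

theorem dia_one_le : diaLinear 1 ≤ 1 := inf_eq_left.1 (mk_eq .dia_one)

theorem dia_mono : Monotone diaLinear := fun a b h => by
  have := dia_nonneg (sub_nonneg.2 h)
  rwa [map_sub, sub_nonneg] at this

theorem abs_dia_le {a b : InitRiesz} (h : |a| ≤ b) : |diaLinear a| ≤ diaLinear b :=
  abs_le'.2 ⟨dia_mono ((le_abs_self a).trans h), by
    rw [← map_neg]; exact dia_mono ((neg_le_abs a).trans h)⟩

/-- Nonexpansiveness of `◇`, which settles the modal case in the inductions on formulas. -/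
theorem abs_dia_le_smul_one {a : InitRiesz} {r : ℝ} (hr : 0 ≤ r) (h : |a| ≤ r • 1) :
    |diaLinear a| ≤ r • 1 :=
  (abs_dia_le h).trans (by
    rw [map_smul]; exact smul_le_smul_of_nonneg_left dia_one_le hr)

theorem abs_sup_sub_sup_le (a b c d : InitRiesz) : |a ⊔ c - b ⊔ d| ≤ |a - b| + |c - d| :=
  calc |a ⊔ c - b ⊔ d| = |(a ⊔ c - b ⊔ c) + (c ⊔ b - d ⊔ b)| := by
        rw [sup_comm c b, sup_comm d b, sub_add_sub_cancel]
    _ ≤ |a ⊔ c - b ⊔ c| + |c ⊔ b - d ⊔ b| := abs_add_le _ _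
    _ ≤ |a - b| + |c - d| :=
        add_le_add (abs_sup_sub_sup_le_abs a b c) (abs_sup_sub_sup_le_abs c d b)

theorem abs_inf_sub_inf_le (a b c d : InitRiesz) : |a ⊓ c - b ⊓ d| ≤ |a - b| + |c - d| :=
  calc |a ⊓ c - b ⊓ d| = |(a ⊓ c - b ⊓ c) + (c ⊓ b - d ⊓ b)| := by
        rw [inf_comm c b, inf_comm d b, sub_add_sub_cancel]
    _ ≤ |a ⊓ c - b ⊓ c| + |c ⊓ b - d ⊓ b| := abs_add_le _ _
    _ ≤ |a - b| + |c - d| :=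
        add_le_add (abs_inf_sub_inf_le_abs a b c) (abs_inf_sub_inf_le_abs c d b)

theorem exists_abs_mk_le (φ : Form) : ∃ r : ℝ, 0 ≤ r ∧ |mk φ| ≤ r • 1 := by
  induction φ with
  | zero => exact ⟨0, le_rfl, by rw [zero_smul]; exact abs_zero.le⟩
  | one => exact ⟨1, zero_le_one, by rw [one_smul]; exact (abs_of_nonneg zero_le_one').le⟩
  | smul t φ ih =>
    obtain ⟨r, hr, h⟩ := ih
    refine ⟨|t| * r, mul_nonneg (abs_nonneg t) hr, (abs_smul_le t (mk φ)).trans ?_⟩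
    rw [mul_smul]
    exact smul_le_smul_of_nonneg_left h (abs_nonneg t)
  | add φ ψ ih₁ ih₂ =>
    obtain ⟨r, hr, h⟩ := ih₁
    obtain ⟨s, hs, k⟩ := ih₂
    refine ⟨r + s, add_nonneg hr hs, (abs_add_le (mk φ) (mk ψ)).trans ?_⟩
    rw [add_smul]
    exact add_le_add h k
  | sup φ ψ ih₁ ih₂ =>
    obtain ⟨r, hr, h⟩ := ih₁
    obtain ⟨s, hs, k⟩ := ih₂
    refine ⟨r + s, add_nonneg hr hs, ?_⟩
    have h1 := abs_sup_sub_sup_le (mk φ) 0 (mk ψ) 0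
    rw [sup_idem, sub_zero, sub_zero, sub_zero] at h1
    rw [add_smul]
    exact h1.trans (add_le_add h k)
  | inf φ ψ ih₁ ih₂ =>
    obtain ⟨r, hr, h⟩ := ih₁
    obtain ⟨s, hs, k⟩ := ih₂
    refine ⟨r + s, add_nonneg hr hs, ?_⟩
    have h1 := abs_inf_sub_inf_le (mk φ) 0 (mk ψ) 0
    rw [inf_idem, sub_zero, sub_zero, sub_zero] at h1
    rw [add_smul]
    exact h1.trans (add_le_add h k)
  | dia φ ih =>
    obtain ⟨r, hr, h⟩ := ih
    exact ⟨r, hr, abs_dia_le_smul_one hr h⟩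

theorem isStrongUnit_one : IsStrongUnit (1 : InitRiesz) := by
  refine ⟨zero_le_one', ?_⟩
  rintro ⟨φ⟩
  obtain ⟨r, -, h⟩ := exists_abs_mk_le φ
  obtain ⟨n, hn⟩ := exists_nat_ge r
  refine ⟨n, h.trans ?_⟩
  rw [← Nat.cast_smul_eq_nsmul ℝ]
  exact smul_le_smul_of_nonneg_right hn zero_le_one'

/-- Every operation is uniformly continuous on bounded sets, so errors in the coefficients can be
controlled by induction. -/
theorem exists_isRational_abs_sub_le (φ : Form) {ε : ℝ} (hε : 0 < ε) :
    ∃ ψ : Form, ψ.IsRational ∧ |mk φ - mk ψ| ≤ ε • 1 := by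
  induction φ generalizing ε with
  | zero => exact ⟨.zero, trivial, by simpa using smul_nonneg hε.le zero_le_one'⟩
  | one => exact ⟨.one, trivial, by simpa using smul_nonneg hε.le zero_le_one'⟩
  | smul t φ ih =>
    obtain ⟨r, hr, h⟩ := exists_abs_mk_le φ
    obtain ⟨q, hq1, hq2⟩ := exists_rat_btwn
      (show t < t + ε / 2 / (r + 1) from lt_add_of_pos_right t (by positivity))
    -- Half of the error is spent on replacing `t` by `q`, half on replacing `φ` by `ψ`. The latter
    -- tolerance depends on `q`, so `q` is chosen first; each `+ 1` keeps a denominator positive.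
    obtain ⟨ψ, hψ, hle⟩ := ih (ε := ε / 2 / (|(q : ℝ)| + 1)) (by positivity)
    refine ⟨.smul q ψ, ⟨⟨q, rfl⟩, hψ⟩, ?_⟩
    have hqt : |t - q| ≤ ε / 2 / (r + 1) := by
      rw [abs_le]; constructor <;> linarith
    calc |t • mk φ - (q : ℝ) • mk ψ| = |(t - q) • mk φ + (q : ℝ) • (mk φ - mk ψ)| := by
          congr 1; module
      _ ≤ |(t - q) • mk φ| + |(q : ℝ) • (mk φ - mk ψ)| := abs_add_le _ _
      _ ≤ |t - q| • |mk φ| + |(q : ℝ)| • |mk φ - mk ψ| :=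
          add_le_add (abs_smul_le _ _) (abs_smul_le _ _)
      _ ≤ |t - q| • r • 1 + |(q : ℝ)| • (ε / 2 / (|(q : ℝ)| + 1)) • 1 :=
          add_le_add (smul_le_smul_of_nonneg_left h (abs_nonneg _))
            (smul_le_smul_of_nonneg_left hle (abs_nonneg _))
      _ = (|t - q| * r + |(q : ℝ)| * (ε / 2 / (|(q : ℝ)| + 1))) • 1 := by module
      _ ≤ ε • 1 := by
          refine smul_le_smul_of_nonneg_right ?_ zero_le_one'
          have h1 : |t - q| * r ≤ ε / 2 := by
            calc |t - q| * r ≤ ε / 2 / (r + 1) * (r + 1) := by gcongr; linarith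
              _ = ε / 2 := div_mul_cancel₀ _ (by positivity)
          have h2 : |(q : ℝ)| * (ε / 2 / (|(q : ℝ)| + 1)) ≤ ε / 2 := by
            calc |(q : ℝ)| * (ε / 2 / (|(q : ℝ)| + 1))
                ≤ (|(q : ℝ)| + 1) * (ε / 2 / (|(q : ℝ)| + 1)) := by gcongr; linarith
              _ = ε / 2 := mul_div_cancel₀ _ (by positivity)
          linarith
  | add φ ψ ih₁ ih₂ =>
    obtain ⟨φ', hφ, h⟩ := ih₁ (half_pos hε)
    obtain ⟨ψ', hψ, k⟩ := ih₂ (half_pos hε)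
    refine ⟨.add φ' ψ', ⟨hφ, hψ⟩, ?_⟩
    calc |(mk φ + mk ψ) - (mk φ' + mk ψ')| = |(mk φ - mk φ') + (mk ψ - mk ψ')| := by
          rw [add_sub_add_comm]
      _ ≤ (ε / 2) • 1 + (ε / 2) • 1 := (abs_add_le _ _).trans (add_le_add h k)
      _ = ε • 1 := by module
  | sup φ ψ ih₁ ih₂ =>
    obtain ⟨φ', hφ, h⟩ := ih₁ (half_pos hε)
    obtain ⟨ψ', hψ, k⟩ := ih₂ (half_pos hε)
    refine ⟨.sup φ' ψ', ⟨hφ, hψ⟩, ?_⟩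
    calc |mk φ ⊔ mk ψ - mk φ' ⊔ mk ψ'| ≤ (ε / 2) • 1 + (ε / 2) • 1 :=
          (abs_sup_sub_sup_le _ _ _ _).trans (add_le_add h k)
      _ = ε • 1 := by module
  | inf φ ψ ih₁ ih₂ =>
    obtain ⟨φ', hφ, h⟩ := ih₁ (half_pos hε)
    obtain ⟨ψ', hψ, k⟩ := ih₂ (half_pos hε)
    refine ⟨.inf φ' ψ', ⟨hφ, hψ⟩, ?_⟩
    calc |mk φ ⊓ mk ψ - mk φ' ⊓ mk ψ'| ≤ (ε / 2) • 1 + (ε / 2) • 1 :=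
          (abs_inf_sub_inf_le _ _ _ _).trans (add_le_add h k)
      _ = ε • 1 := by module
  | dia φ ih =>
    obtain ⟨φ', hφ, h⟩ := ih hε
    refine ⟨.dia φ', hφ, ?_⟩
    have h1 := abs_dia_le_smul_one hε.le h
    rwa [map_sub] at h1

/-- Monotonicity turns the bounds `n|a| ≤ |b|` into `n|◇a| ≤ ◇|b|`; hence `◇` descends to the
quotient. -/
theorem dia_mem_infIdeal {a : InitRiesz} (ha : a ∈ infIdeal InitRiesz) :
    diaLinear a ∈ infIdeal InitRiesz := by
  obtain ⟨b, hb⟩ := ha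
  refine ⟨diaLinear |b|, fun n => ?_⟩
  calc n • |diaLinear a| ≤ n • diaLinear |a| := nsmul_le_nsmul_right (abs_dia_le le_rfl) n
    _ = diaLinear (n • |a|) := (map_nsmul diaLinear n _).symm
    _ ≤ diaLinear |b| := dia_mono (hb n)
    _ ≤ _ := le_abs_self _

end InitRiesz

/-- The set of rational formulas is countable. -/
theorem countable_isRational : {φ : Form | φ.IsRational}.Countable := by
  -- One round of applying every operation with rational scalars, keeping the old formulas;
  -- iteration exhausts the rational formulas.
  let T : Set Form → Set Form := fun S =>
    S ∪ Set.image2 (fun (q : ℚ) φ => Form.smul q φ) Set.univ S ∪ Set.image2 Form.add S S ∪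
      Set.image2 Form.sup S S ∪ Set.image2 Form.inf S S ∪ Form.dia '' S
  let S : ℕ → Set Form := fun n => T^[n] {.zero, .one}
  have hS : ∀ n, S (n + 1) = T (S n) := fun n => Function.iterate_succ_apply' T n _
  have hc : ∀ n, (S n).Countable := by
    intro n
    induction n with
    | zero => exact (Set.toFinite ({.zero, .one} : Set Form)).countable
    | succ n ih =>
      rw [hS]
      exact ((((ih.union (Set.countable_univ.image2 ih _)).union (ih.image2 ih _)).union
        (ih.image2 ih _)).union (ih.image2 ih _)).union (ih.image _)
  have hmono : Monotone S := monotone_nat_of_le_succ fun n φ hφ => by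
    rw [hS]; exact .inl (.inl (.inl (.inl (.inl hφ))))
  have join : ∀ {φ ψ : Form}, (∃ n, φ ∈ S n) → (∃ n, ψ ∈ S n) → ∃ n, φ ∈ S n ∧ ψ ∈ S n := by
    rintro φ ψ ⟨n, hn⟩ ⟨m, hm⟩
    exact ⟨max n m, hmono (le_max_left n m) hn, hmono (le_max_right n m) hm⟩
  refine (Set.countable_iUnion hc).mono fun φ hφ => Set.mem_iUnion.2 ?_
  change φ.IsRational at hφ
  induction φ with
  | zero => exact ⟨0, .inl rfl⟩
  | one => exact ⟨0, .inr rfl⟩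
  | smul r φ ih =>
    obtain ⟨⟨q, rfl⟩, h⟩ := hφ
    obtain ⟨n, hn⟩ := ih h
    refine ⟨n + 1, ?_⟩
    rw [hS]
    exact .inl (.inl (.inl (.inl (.inr ⟨q, trivial, φ, hn, rfl⟩))))
  | add φ ψ ih₁ ih₂ =>
    obtain ⟨n, h, k⟩ := join (ih₁ hφ.1) (ih₂ hφ.2)
    refine ⟨n + 1, ?_⟩
    rw [hS]
    exact .inl (.inl (.inl (.inr ⟨φ, h, ψ, k, rfl⟩)))
  | sup φ ψ ih₁ ih₂ =>
    obtain ⟨n, h, k⟩ := join (ih₁ hφ.1) (ih₂ hφ.2)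
    refine ⟨n + 1, ?_⟩
    rw [hS]
    exact .inl (.inl (.inr ⟨φ, h, ψ, k, rfl⟩))
  | inf φ ψ ih₁ ih₂ =>
    obtain ⟨n, h, k⟩ := join (ih₁ hφ.1) (ih₂ hφ.2)
    refine ⟨n + 1, ?_⟩
    rw [hS]
    exact .inl (.inr ⟨φ, h, ψ, k, rfl⟩)
  | dia φ ih =>
    obtain ⟨n, hn⟩ := ih hφ
    refine ⟨n + 1, ?_⟩
    rw [hS]
    exact .inr ⟨φ, hn, rfl⟩

/-! ### The Archimedean quotient -/

namespace ArchInit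

/-- The quotient map. -/
def ofInit : InitRiesz →ₗ[ℝ] ArchInit := (infIdeal InitRiesz).mkQ

theorem ofInit_surjective : Function.Surjective ofInit := Submodule.mkQ_surjective _

theorem isRieszHom_ofInit : IsRieszHom ofInit := ⟨fun _ _ => rfl, fun _ _ => rfl⟩

theorem ofInit_one : ofInit 1 = 1 := rfl

theorem ofInit_eq_zero_iff {a : InitRiesz} : ofInit a = 0 ↔ InfinitelySmall a :=
  Submodule.Quotient.mk_eq_zero (infIdeal InitRiesz)

theorem mk_surjective : Function.Surjective mk := fun a => by
  obtain ⟨⟨φ⟩, rfl⟩ := ofInit_surjective a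
  exact ⟨φ, rfl⟩

theorem isStrongUnit_one : IsStrongUnit (1 : ArchInit) := by
  refine ⟨by simpa [ofInit_one] using isRieszHom_ofInit.monotone InitRiesz.zero_le_one',
    fun a => ?_⟩
  obtain ⟨a, rfl⟩ := ofInit_surjective a
  obtain ⟨n, hn⟩ := InitRiesz.isStrongUnit_one.2 a
  refine ⟨n, ?_⟩
  have h := isRieszHom_ofInit.monotone hn
  rwa [isRieszHom_ofInit.map_abs, map_nsmul, ofInit_one] at h

/-- Inequalities in the quotient lift up to one unit: if all multiples of `(a - b)⁺` lie below `m ·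
1`, the multiple by `m + 1` gives `(a - b)⁺ ≤ 1`. -/
theorem le_add_one_of_ofInit_le {a b : InitRiesz} (h : ofInit a ≤ ofInit b) : a ≤ b + 1 := by
  have h0 : ofInit (a - b)⁺ = 0 := by
    rw [isRieszHom_ofInit.map_posPart, map_sub, posPart_eq_zero, sub_nonpos]
    exact h
  obtain ⟨c, hc⟩ := ofInit_eq_zero_iff.1 h0
  obtain ⟨m, hm⟩ := InitRiesz.isStrongUnit_one.2 c
  have h1 : ((m : ℝ) + 1) • (a - b)⁺ ≤ ((m : ℝ) + 1) • (1 : InitRiesz) := by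
    have h2 := (hc (m + 1)).trans hm
    rw [abs_of_nonneg (posPart_nonneg _), ← Nat.cast_smul_eq_nsmul ℝ,
      ← Nat.cast_smul_eq_nsmul ℝ, Nat.cast_succ] at h2
    exact h2.trans (smul_le_smul_of_nonneg_right (by linarith) InitRiesz.zero_le_one')
  have h3 := smul_le_smul_of_nonneg_left h1 (show (0 : ℝ) ≤ ((m : ℝ) + 1)⁻¹ by positivity)
  rw [inv_smul_smul₀ (by positivity), inv_smul_smul₀ (by positivity)] at h3
  exact sub_le_iff_le_add'.1 ((le_posPart _).trans h3)

/-- The lifting error is one unit for every `n`, so `|b| + 1` is a common bound upstairs. -/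
theorem isArchimedeanRiesz : IsArchimedeanRiesz ArchInit := by
  rintro a ⟨b, hb⟩
  obtain ⟨a, rfl⟩ := ofInit_surjective a
  obtain ⟨b, rfl⟩ := ofInit_surjective b
  refine ofInit_eq_zero_iff.2 ⟨|b| + 1, fun n => ?_⟩
  rw [abs_of_nonneg (add_nonneg (abs_nonneg b) InitRiesz.zero_le_one')]
  refine le_add_one_of_ofInit_le ?_
  rw [map_nsmul, isRieszHom_ofInit.map_abs, isRieszHom_ofInit.map_abs]
  exact hb n

/-- The classes of the rational formulas. -/
theorem countable_rational : {a : ArchInit | ∃ φ : Form, φ.IsRational ∧ a = mk φ}.Countable :=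
  (countable_isRational.image mk).mono (by rintro _ ⟨φ, hφ, rfl⟩; exact ⟨φ, hφ, rfl⟩)

theorem unitNormDense_rational :
    UnitNormDense (1 : ArchInit) {a | ∃ φ : Form, φ.IsRational ∧ a = mk φ} := by
  intro a ε hε
  obtain ⟨φ, rfl⟩ := mk_surjective a
  obtain ⟨ψ, hψ, h⟩ := InitRiesz.exists_isRational_abs_sub_le φ (half_pos hε)
  refine ⟨mk ψ, ⟨ψ, hψ, rfl⟩, (unitNorm_le (half_pos hε).le ?_).trans_lt (half_lt_self hε)⟩
  have h1 := isRieszHom_ofInit.monotone h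
  rwa [isRieszHom_ofInit.map_abs, map_sub, map_smul, ofInit_one] at h1

theorem unitNormSeparable : UnitNormSeparable (1 : ArchInit) :=
  ⟨_, countable_rational, unitNormDense_rational⟩

/-- The modality on the Archimedean quotient. -/
def dia : ArchInit →ₗ[ℝ] ArchInit :=
  Submodule.mapQ (infIdeal InitRiesz) (infIdeal InitRiesz) InitRiesz.diaLinear
    fun _ => InitRiesz.dia_mem_infIdeal

theorem dia_ofInit (a : InitRiesz) : dia (ofInit a) = ofInit (InitRiesz.diaLinear a) := rfl

theorem dia_mk (φ : Form) : dia (mk φ) = mk (.dia φ) := rfl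

theorem dia_nonneg {a : ArchInit} (ha : 0 ≤ a) : 0 ≤ dia a := by
  obtain ⟨b, rfl⟩ := ofInit_surjective a
  -- A positive class has a positive representative.
  have h : ofInit b = ofInit b⁺ := by
    rw [isRieszHom_ofInit.map_posPart, posPart_of_nonneg ha]
  rw [h, dia_ofInit, ← map_zero ofInit]
  exact isRieszHom_ofInit.monotone (InitRiesz.dia_nonneg (posPart_nonneg b))

theorem dia_one_le : dia 1 ≤ 1 := isRieszHom_ofInit.monotone InitRiesz.dia_one_le

end ArchInit

/-! ### Interpretation of formulas in Markov processes -/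

section Interpretation

variable {X : Type u} [TopologicalSpace X] [CompactSpace X]

/-- The semantics of the modality: the expectation of a function after one step. -/
def nextExpect (β : MarkovProcess X) (f : C(X, ℝ)) : C(X, ℝ) :=
  ⟨fun x => (β x).expect f, (RadonSubprob.continuous_expect f).comp β.continuous⟩

theorem nextExpect_apply (β : MarkovProcess X) (f : C(X, ℝ)) (x : X) :
    nextExpect β f x = (β x).expect f := rfl

/-- The semantics of formulas. -/
def interp (β : MarkovProcess X) : Form → C(X, ℝ)
  | .zero => 0
  | .one => 1
  | .smul r φ => r • interp β φ
  | .add φ ψ => interp β φ + interp β ψ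
  | .sup φ ψ => interp β φ ⊔ interp β ψ
  | .inf φ ψ => interp β φ ⊓ interp β ψ
  | .dia φ => nextExpect β (interp β φ)

/-- Provably equal formulas have the same semantics. -/
theorem interp_eq_of_provable (β : MarkovProcess X) {φ ψ : Form} (h : Provable φ ψ) :
    interp β φ = interp β ψ := by
  induction h with
  | refl x => rfl
  | symm _ ih => exact ih.symm
  | trans _ _ ih₁ ih₂ => exact ih₁.trans ih₂
  | smul_congr r _ ih => simp only [interp, ih]
  | add_congr _ _ ih₁ ih₂ => simp only [interp, ih₁, ih₂]
  | sup_congr _ _ ih₁ ih₂ => simp only [interp, ih₁, ih₂]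
  | inf_congr _ _ ih₁ ih₂ => simp only [interp, ih₁, ih₂]
  | dia_congr _ ih => simp only [interp, ih]
  | add_assoc x y z => exact (_root_.add_assoc _ _ _).symm
  | add_comm x y => exact _root_.add_comm _ _
  | add_zero x => exact _root_.add_zero _
  | add_neg x => simp [interp]
  | smul_smul r s x => exact _root_.smul_smul _ _ _
  | one_smul x => exact _root_.one_smul _ _
  | smul_add r x y => exact _root_.smul_add _ _ _
  | add_smul r s x => exact _root_.add_smul _ _ _
  | sup_assoc x y z => exact (_root_.sup_assoc _ _ _).symm
  | inf_assoc x y z => exact (_root_.inf_assoc _ _ _).symm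
  | sup_comm x y => exact _root_.sup_comm _ _
  | inf_comm x y => exact _root_.inf_comm _ _
  | sup_absorb x y => exact sup_inf_self
  | inf_absorb x y => exact inf_sup_self
  | sup_idem x => exact _root_.sup_idem _
  | inf_idem x => exact _root_.inf_idem _
  | add_compat x y z =>
    refine inf_eq_left.2 fun t => ?_
    exact add_le_add (inf_le_right : interp β x t ⊓ interp β y t ≤ _) le_rfl
  | smul_compat r x y hr =>
    refine inf_eq_left.2 fun t => ?_
    exact mul_le_mul_of_nonneg_left (inf_le_right : interp β x t ⊓ interp β y t ≤ _) hr
  | zero_le_one => exact inf_eq_left.2 fun t => _root_.zero_le_one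
  | dia_linear r s x y =>
    ext t
    change (β t).expect (r • interp β x + s • interp β y) =
      r * (β t).expect (interp β x) + s * (β t).expect (interp β y)
    rw [RadonSubprob.expect_add, RadonSubprob.expect_smul, RadonSubprob.expect_smul]
  | dia_pos x =>
    refine inf_eq_left.2 fun t => (β t).expect_nonneg (f := interp β x ⊔ 0) le_sup_right
  | dia_one => exact inf_eq_left.2 fun t => (β t).expect_one_le

/-- The semantics on the initial modal Riesz space. -/
def interpInit (β : MarkovProcess X) : InitRiesz →ₗ[ℝ] C(X, ℝ) where
  toFun := Quotient.lift (interp β) fun _ _ h => interp_eq_of_provable β h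
  map_add' := by rintro ⟨φ⟩ ⟨ψ⟩; rfl
  map_smul' := by rintro r ⟨φ⟩; rfl

theorem isRieszHom_interpInit (β : MarkovProcess X) : IsRieszHom (interpInit β) :=
  ⟨by rintro ⟨φ⟩ ⟨ψ⟩; rfl, by rintro ⟨φ⟩ ⟨ψ⟩; rfl⟩

/-- Values at a state are real numbers, and the real line has no nonzero infinitely small element.
-/
theorem interpInit_eq_zero (β : MarkovProcess X) {a : InitRiesz} (ha : InfinitelySmall a) :
    interpInit β a = 0 := by
  obtain ⟨b, hb⟩ := ha
  ext x
  have h : ∀ n : ℕ, n • |interpInit β a x| ≤ |interpInit β b x| := by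
    intro n
    have h1 := (isRieszHom_interpInit β).monotone (hb n)
    rw [map_nsmul, (isRieszHom_interpInit β).map_abs, (isRieszHom_interpInit β).map_abs] at h1
    simpa using h1 x
  by_contra hne
  obtain ⟨n, hn⟩ := Archimedean.arch (|interpInit β b x| + 1) (abs_pos.2 hne)
  linarith [h n]

/-- The semantics on the initial Archimedean modal Riesz space. -/
def interpArch (β : MarkovProcess X) : ArchInit →ₗ[ℝ] C(X, ℝ) :=
  Submodule.liftQ (infIdeal InitRiesz) (interpInit β) fun _ ha => interpInit_eq_zero β ha

theorem interpArch_mk (β : MarkovProcess X) (φ : Form) :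
    interpArch β (ArchInit.mk φ) = interp β φ := rfl

theorem interpArch_one (β : MarkovProcess X) : interpArch β 1 = 1 := rfl

theorem interpArch_dia (β : MarkovProcess X) (a : ArchInit) :
    interpArch β (ArchInit.dia a) = nextExpect β (interpArch β a) := by
  obtain ⟨φ, rfl⟩ := ArchInit.mk_surjective a
  rfl

theorem interpArch_sup (β : MarkovProcess X) (a b : ArchInit) :
    interpArch β (a ⊔ b) = interpArch β a ⊔ interpArch β b := by
  obtain ⟨φ, rfl⟩ := ArchInit.mk_surjective a
  obtain ⟨ψ, rfl⟩ := ArchInit.mk_surjective b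
  rfl

theorem interpArch_inf (β : MarkovProcess X) (a b : ArchInit) :
    interpArch β (a ⊓ b) = interpArch β a ⊓ interpArch β b := by
  obtain ⟨φ, rfl⟩ := ArchInit.mk_surjective a
  obtain ⟨ψ, rfl⟩ := ArchInit.mk_surjective b
  rfl

/-- The theory of a state: the Riesz homomorphism that evaluates formulas at `x`. -/
def theoryHom (β : MarkovProcess X) (x : X) : ArchInit →ₗ[ℝ] ℝ where
  toFun a := interpArch β a x
  map_add' a b := by rw [map_add, ContinuousMap.add_apply]
  map_smul' r a := by rw [map_smul]; rfl

theorem isRieszHom_theoryHom (β : MarkovProcess X) (x : X) : IsRieszHom (theoryHom β x) :=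
  ⟨fun a b => DFunLike.congr_fun (interpArch_sup β a b) x,
    fun a b => DFunLike.congr_fun (interpArch_inf β a b) x⟩

theorem theoryHom_one (β : MarkovProcess X) (x : X) : theoryHom β x 1 = 1 :=
  DFunLike.congr_fun (interpArch_one β) x

/-- The map that sends a state to its theory. -/
def theoryMap (β : MarkovProcess X) : C(X, Spec ArchInit) where
  toFun x := pointOfHom ArchInit.isStrongUnit_one (isRieszHom_theoryHom β x) (theoryHom_one β x)
  continuous_toFun := by
    -- Continuity into the spectrum is tested on one element of `𝕀ₐ` at a time.
    rw [(isClosedEmbedding_character ArchInit.isStrongUnit_one).isInducing.continuous_iff]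
    refine continuous_pi fun a => ?_
    simp only [Function.comp_def, character_pointOfHom]
    exact (interpArch β a).continuous

theorem character_theoryMap (β : MarkovProcess X) (x : X) (a : ArchInit) :
    character ArchInit.isStrongUnit_one (theoryMap β x) a = interpArch β a x :=
  character_pointOfHom _ (isRieszHom_theoryHom β x) (theoryHom_one β x) a

theorem toContinuous_comp_theoryMap (β : MarkovProcess X) (a : ArchInit) :
    (toContinuous ArchInit.isStrongUnit_one a).comp (theoryMap β) = interpArch β a :=
  ContinuousMap.ext fun x => character_theoryMap β x a

theorem RadonSubprob.continuous_expect_right (μ : RadonSubprob X) : Continuous μ.expect :=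
  AddMonoidHomClass.continuous_of_bound μ.expectLinear 1 fun f => by
    rw [one_mul]; exact μ.abs_expect_le f

end Interpretation

/-! ### The final Markov process -/

instance : CompactSpace (Spec ArchInit) := compactSpace_spec ArchInit.isStrongUnit_one

instance : T2Space (Spec ArchInit) := t2Space_spec ArchInit.isStrongUnit_one

/-- Since `◇` is positive and `◇1 ≤ 1`, so is its composite with a character, now as a functional.
-/
theorem exists_expect_eq_character_dia (J : Spec ArchInit) :
    ∃ μ : RadonSubprob (Spec ArchInit), ∀ a,
      μ.expect (toContinuous ArchInit.isStrongUnit_one a) =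
        character ArchInit.isStrongUnit_one J (ArchInit.dia a) := by
  have hmono := (isRieszHom_character ArchInit.isStrongUnit_one J).monotone
  refine exists_expect_toContinuous_eq ArchInit.isArchimedeanRiesz ArchInit.isStrongUnit_one
    (character ArchInit.isStrongUnit_one J ∘ₗ ArchInit.dia) (fun a ha => ?_) ?_
  · simpa using hmono (ArchInit.dia_nonneg ha)
  · simpa [character_unit] using hmono ArchInit.dia_one_le

/-- The transition measure of the canonical process at `J`. -/
def canonicalMeasure (J : Spec ArchInit) : RadonSubprob (Spec ArchInit) :=
  (exists_expect_eq_character_dia J).choose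

theorem expect_canonicalMeasure (J : Spec ArchInit) (a : ArchInit) :
    (canonicalMeasure J).expect (toContinuous ArchInit.isStrongUnit_one a) =
      character ArchInit.isStrongUnit_one J (ArchInit.dia a) :=
  (exists_expect_eq_character_dia J).choose_spec a

/-- The canonical Markov process on the spectrum of the initial Archimedean modal Riesz space. -/
def canonicalProcess : MarkovProcess (Spec ArchInit) where
  toFun := canonicalMeasure
  continuous_toFun := by
    refine RadonSubprob.continuous_of_continuous_expect fun f => ?_
    -- For `f` coming from `a`, the expectation is the continuous function `J ↦ (◇a)(J)`. Other `f`
    -- are uniform limits of these, and expectations do not increase the norm.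
    refine continuous_of_uniform_approx_of_continuous fun u hu => ?_
    obtain ⟨ε, hε, hεu⟩ := Metric.mem_uniformity_dist.1 hu
    obtain ⟨a, ha⟩ := exists_norm_sub_toContinuous_lt ArchInit.isStrongUnit_one f hε
    refine ⟨_, continuous_character ArchInit.isStrongUnit_one (ArchInit.dia a), fun J => ?_⟩
    refine hεu ?_
    rw [← expect_canonicalMeasure, Real.dist_eq, ← RadonSubprob.expect_sub]
    exact (RadonSubprob.abs_expect_le _ _).trans_lt ha

/-- Both sides are continuous in the test function, so test functions coming from `a` suffice; there
both sides are the interpretation of `◇a` at `x`. -/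
theorem isMarkovHom_theoryMap {X : Type v} [TopologicalSpace X] [CompactSpace X]
    (β : MarkovProcess X) : IsMarkovHom β canonicalProcess (theoryMap β) := by
  intro x
  refine congrFun ((denseRange_toContinuous ArchInit.isStrongUnit_one).equalizer
    (RadonSubprob.continuous_expect_right _)
    ((RadonSubprob.continuous_expect_right _).comp (ContinuousMap.continuous_precomp _))
    (funext fun a => ?_))
  change (canonicalMeasure (theoryMap β x)).expect _ = (β x).expect _
  rw [expect_canonicalMeasure, character_theoryMap, interpArch_dia, toContinuous_comp_theoryMap,
    nextExpect_apply]

/-- The source of uniqueness. Only the modal case uses the morphism property: it moves the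
expectation of `φ` from `f x` back to `x`. That expectation ranges over all states, hence the
induction hypothesis for every `x`. -/
theorem character_eq_interp_of_isMarkovHom {X : Type v} [TopologicalSpace X] [CompactSpace X]
    {β : MarkovProcess X} {f : C(X, Spec ArchInit)} (hf : IsMarkovHom β canonicalProcess f)
    (φ : Form) (x : X) :
    character ArchInit.isStrongUnit_one (f x) (ArchInit.mk φ) = interp β φ x := by
  induction φ generalizing x with
  | zero => exact map_zero _
  | one => exact character_unit _ _
  | smul r φ ih =>
    exact (map_smul (character _ (f x)) r (ArchInit.mk φ)).trans (congrArg (r * ·) (ih x))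
  | add φ ψ ih₁ ih₂ =>
    exact (map_add (character _ (f x)) (ArchInit.mk φ) (ArchInit.mk ψ)).trans
      (congrArg₂ (· + ·) (ih₁ x) (ih₂ x))
  | sup φ ψ ih₁ ih₂ =>
    exact ((isRieszHom_character _ (f x)).1 (ArchInit.mk φ) (ArchInit.mk ψ)).trans
      (congrArg₂ (· ⊔ ·) (ih₁ x) (ih₂ x))
  | inf φ ψ ih₁ ih₂ =>
    exact ((isRieszHom_character _ (f x)).2 (ArchInit.mk φ) (ArchInit.mk ψ)).trans
      (congrArg₂ (· ⊓ ·) (ih₁ x) (ih₂ x))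
  | dia φ ih =>
    rw [← ArchInit.dia_mk, ← expect_canonicalMeasure]
    refine (hf x _).trans (congrArg (β x).expect ?_)
    exact ContinuousMap.ext ih

theorem isFinalMarkov_canonicalProcess : IsFinalMarkov.{0, v} canonicalProcess := by
  intro X _ _ _ β
  refine ⟨theoryMap β, isMarkovHom_theoryMap β, fun f hf => ContinuousMap.ext fun x => ?_⟩
  refine spec_ext ArchInit.isStrongUnit_one fun a => ?_
  obtain ⟨φ, rfl⟩ := ArchInit.mk_surjective a
  rw [character_eq_interp_of_isMarkovHom hf, character_theoryMap, interpArch_mk]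

end

end RieszModal

open RieszModal in
theorem theorem6p13 :
    -- separable Archimedean unital Riesz spaces have a compact Polish spectrum
    (∀ (A : Type u) [AddCommGroup A] [Lattice A] [IsOrderedAddMonoid A] [Module ℝ A]
        [PosSMulMono ℝ A] (e : A),
        IsArchimedeanRiesz A → IsStrongUnit e → UnitNormSeparable e →
          CompactSpace (Spec A) ∧ PolishSpace (Spec A)) ∧
    -- the initial Archimedean modal Riesz space is Archimedean, unital and separable, the classes
    -- of the formulas with rational coefficients being countably many and dense
    (IsArchimedeanRiesz ArchInit ∧ IsStrongUnit (1 : ArchInit) ∧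
      UnitNormSeparable (1 : ArchInit) ∧
      {a : ArchInit | ∃ φ : Form, φ.IsRational ∧ a = ArchInit.mk φ}.Countable ∧
      UnitNormDense (1 : ArchInit)
        {a : ArchInit | ∃ φ : Form, φ.IsRational ∧ a = ArchInit.mk φ}) ∧
    -- its spectrum is compact Polish, and it is the state space of the final Markov process
    (CompactSpace (Spec ArchInit) ∧ PolishSpace (Spec ArchInit) ∧
      ∃ α : MarkovProcess (Spec ArchInit), IsFinalMarkov.{0, v} α) := by
  exact ⟨fun A _ _ _ _ _ e _ he hsep => ⟨compactSpace_spec he, polishSpace_spec he hsep⟩,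
    ⟨ArchInit.isArchimedeanRiesz, ArchInit.isStrongUnit_one, ArchInit.unitNormSeparable,
      ArchInit.countable_rational, ArchInit.unitNormDense_rational⟩,
    inferInstance, polishSpace_spec ArchInit.isStrongUnit_one ArchInit.unitNormSeparable,
    canonicalProcess, isFinalMarkov_canonicalProcess⟩
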